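/- Let $p\ge 0$ be an integer. A conditional independence statement is a statement $X_i \perp X_j \mid X_C$ with $i\neq j$ in $\{1,\dots,p\}$ and $C\subseteq\{1,\dots,p\}\setminus\{i,j\}$ (possibly empty); $X_i\perp X_j\mid X_C$ and $X_j\perp X_i\mid X_C$ are the same statement. An independence model $\mathcal I$ is a collection of such statements; it is simple if it contains at most one statement for each unordered pair $\{i,j\}$, and distinct $i,j$ are adjacent in $\mathcal I$ if it contains no statement for $\{i,j\}$. Let $\Theta$ be either the space of positive definite $p\times p$ covariance matrices, regarded as an open subset of $\mathbb R^{p(p+1)/2}$ through the entries $\sigma_{ij}$, $i\le j$, or the space of positive definite $p\times p$ correlation matrices, regarded as an open subset of $\mathbb R^{p(p-1)/2}$ through the entries $\rho_{ij}$, $i<j$. Let $\mathcal M(\mathcal I)\subseteq\Theta$ be the set of $\Sigma\in\Theta$ such that all statements in $\mathcal I$ hold for $X\sim N(0,\Sigma)$. For $\mathcal M_1,\mathcal M_2\subseteq\Theta$, $\theta\in\mathcal M_1\cap\mathcal M_2$ and $\varepsilon>0$, let $D_\varepsilon$ be the Hausdorff distance between $\mathcal M_1\cap N_\varepsilon(\theta)$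 and $\mathcal M_2\cap N_\varepsilon(\theta)$, where $N_\varepsilon(\theta)$ is the ball of radius $\varepsilon$ around $\theta$. The sets are $c$-equivalent at $\theta$ if $D_\varepsilon=o(\varepsilon^c)$, and $c$-near-equivalent at $\theta$ if $D_\varepsilon=O(\varepsilon^c)$, as $\varepsilon\downarrow0$. An algebraic model is a subset $V\subseteq\Theta$ cut out in $\Theta$ by polynomial equations; it is irreducible if it is nonempty and not a union of two proper algebraic submodels. The dimension of a set $A \subseteq \Theta$ is the Krull dimension of $\mathbb R[x]/I(A)$, where $I(A)$ is the ideal of polynomials vanishing on $A$. Theorem. Let $\mathcal I_1,\mathcal I_2$ be simple independence models. In both choices of $\Theta$: (a) If $\mathcal I_1$ and $\mathcal I_2$ have the same adjacencies, then $\mathcal M(\mathcal I_1)$ and $\mathcal M(\mathcal I_2)$ are $2$-near-equivalent at every diagonal matrix in $\Theta$; in particular at the identity matrix, which is the only diagonal correlation matrix. (b) If $\mathcal I_1$ and $\mathcal I_2$ have different adjacencies, then for every irreducible algebraic model $V\subseteq\Theta$ that contains the identity matrix (or, more generally, some diagonal matrix), the set of points of $V$ at which $\mathcal M(\mathcal I_1)$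 and $\mathcal M(\mathcal I_2)$ are $1$-equivalent is a null subset of $V$: its dimension is strictly smaller than $d=\dim V$, and its $d$-dimensional Hausdorff measure is zero. -/

import Mathlib

open MeasureTheory ProbabilityTheory Filter Topology Asymptotics

noncomputable section

namespace LocalEquiv

/-! ### Local comparison of models (subsets of Euclidean parameter space) -/

section Models

variable {ι : Type*} [Fintype ι]

/-- `M₁` and `M₂` are `c`-equivalent at the common point `θ`: the Hausdorff distance between their
parts in the `ε`-ball around `θ` is `o(ε ^ c)` as `ε ↓ 0`. -/
def IsEquivAt (c : ℝ) (M₁ M₂ : Set (EuclideanSpace ℝ ι)) (θ : EuclideanSpace ℝ ι) : Prop :=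
  θ ∈ M₁ ∩ M₂ ∧
    (fun ε : ℝ => Metric.hausdorffDist (M₁ ∩ Metric.ball θ ε) (M₂ ∩ Metric.ball θ ε))
      =o[𝓝[>] 0] (fun ε : ℝ => ε ^ c)

/-- `M₁` and `M₂` are `c`-near-equivalent at the common point `θ`: the Hausdorff distance between
their parts in the `ε`-ball around `θ` is `O(ε ^ c)` as `ε ↓ 0`. -/
def IsNearEquivAt (c : ℝ) (M₁ M₂ : Set (EuclideanSpace ℝ ι)) (θ : EuclideanSpace ℝ ι) : Prop :=
  θ ∈ M₁ ∩ M₂ ∧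
    (fun ε : ℝ => Metric.hausdorffDist (M₁ ∩ Metric.ball θ ε) (M₂ ∩ Metric.ball θ ε))
      =O[𝓝[>] 0] (fun ε : ℝ => ε ^ c)

/-- `A` is an algebraic submodel of the parameter space `Θ`: the set of all points of `Θ` at which
some family of polynomials vanishes. -/
def IsAlgebraicModel (Θ A : Set (EuclideanSpace ℝ ι)) : Prop :=
  ∃ P : Set (MvPolynomial ι ℝ), A = {θ ∈ Θ | ∀ f ∈ P, MvPolynomial.eval (fun k => θ k) f = 0}

/-- `A` is an irreducible algebraic submodel of `Θ`: it is nonempty, and not the union of two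
proper algebraic submodels. -/
def IsIrreducibleModel (Θ A : Set (EuclideanSpace ℝ ι)) : Prop :=
  IsAlgebraicModel Θ A ∧ A.Nonempty ∧
    ∀ B C : Set (EuclideanSpace ℝ ι), IsAlgebraicModel Θ B → IsAlgebraicModel Θ C →
      A = B ∪ C → A = B ∨ A = C

/-- The dimension of a (semialgebraic) set `A`: the Krull dimension of the ring of polynomial
functions on `A`, that is, of `ℝ[x] / I(A)`. The empty set has dimension `⊥`. -/
def modelDim (A : Set (EuclideanSpace ℝ ι)) : WithBot ℕ∞ :=
  ringKrullDim (MvPolynomial ι ℝ ⧸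
    MvPolynomial.vanishingIdeal ℝ ((fun θ : EuclideanSpace ℝ ι => fun k => θ k) '' A))

/-- `S ∩ A` is a null subset of the `d`-dimensional algebraic model `A`: it has dimension strictly
smaller than `d`, and its `d`-dimensional Hausdorff measure is zero. -/
def IsNullWithin (A S : Set (EuclideanSpace ℝ ι)) : Prop :=
  ∃ d : ℕ, modelDim A = d ∧ modelDim (S ∩ A) < d ∧ Measure.hausdorffMeasure (d : ℝ) (S ∩ A) = 0

end Models

/-! ### Gaussian conditional independence models -/

/-- A conditional independence statement `X i ⫫ X j ∣ X C` about `X = (X 0, …, X (p - 1))`. -/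
structure CIStatement (p : ℕ) where
  i : Fin p
  j : Fin p
  C : Finset (Fin p)
  ne : i ≠ j
  left_notMem : i ∉ C
  right_notMem : j ∉ C

/-- An independence model is a collection of conditional independence statements. -/
abbrev IndepModel (p : ℕ) := Set (CIStatement p)

/-- At most one independence statement for each unordered pair `{i, j}`
(`X i ⫫ X j ∣ X C` and `X j ⫫ X i ∣ X C` are the same statement). -/
def IndepModel.IsSimple {p : ℕ} (I : IndepModel p) : Prop :=
  ∀ s ∈ I, ∀ t ∈ I, s(s.i, s.j) = s(t.i, t.j) → s.C = t.C

/-- Distinct `i, j` are adjacent if `I` contains no independence statement between them. -/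
def IndepModel.adjacency {p : ℕ} (I : IndepModel p) : SimpleGraph (Fin p) where
  Adj i j := i ≠ j ∧ ∀ s ∈ I, s(s.i, s.j) ≠ s(i, j)
  symm := ⟨fun i j h => ⟨h.1.symm, by rw [Sym2.eq_swap]; exact h.2⟩⟩
  loopless := ⟨fun _ h => h.1 rfl⟩

/-- The subvector `x_C` of `x`. -/
def subvector {p : ℕ} (C : Finset (Fin p)) (x : EuclideanSpace ℝ (Fin p)) : C → ℝ :=
  fun k => x k

lemma comap_subvector_le {p : ℕ} (C : Finset (Fin p)) :
    MeasurableSpace.comap (subvector C) inferInstance ≤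
      (inferInstance : MeasurableSpace (EuclideanSpace ℝ (Fin p))) := by
  apply Measurable.comap_le
  unfold subvector
  fun_prop

/-- The statement `s` holds for the Gaussian distribution with mean zero and covariance `S`:
the coordinates `x i` and `x j` are conditionally independent given the σ-algebra generated by
the subvector `x_C`. -/
def CIStatement.Holds {p : ℕ} (s : CIStatement p) (S : Matrix (Fin p) (Fin p) ℝ) : Prop :=
  CondIndepFun (MeasurableSpace.comap (subvector s.C) inferInstance) (comap_subvector_le s.C)
    (fun x : EuclideanSpace ℝ (Fin p) => x s.i) (fun x : EuclideanSpace ℝ (Fin p) => x s.j)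
    (multivariateGaussian 0 S)

/-- Index set for covariance parameters: the unordered pairs `{i, j}`, with `i = j` allowed. -/
abbrev CovIndex (p : ℕ) := Sym2 (Fin p)

/-- Index set for correlation parameters: the unordered pairs `{i, j}` with `i ≠ j`. -/
abbrev CorIndex (p : ℕ) := {e : Sym2 (Fin p) // ¬ e.IsDiag}

/-- The symmetric matrix with entries `σ_{ij} = θ_{{i, j}}`. -/
def toCov {p : ℕ} (θ : EuclideanSpace ℝ (CovIndex p)) : Matrix (Fin p) (Fin p) ℝ :=
  Matrix.of fun i j => θ s(i, j)

/-- The symmetric matrix with unit diagonal and entries `ρ_{ij} = θ_{{i, j}}` for `i ≠ j`. -/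
def toCor {p : ℕ} (θ : EuclideanSpace ℝ (CorIndex p)) : Matrix (Fin p) (Fin p) ℝ :=
  Matrix.of fun i j => if h : i = j then 1 else θ ⟨s(i, j), h⟩

/-- The space of `p × p` positive definite covariance matrices, an open subset of
`ℝ ^ (p (p + 1) / 2)`. -/
def covSpace (p : ℕ) : Set (EuclideanSpace ℝ (CovIndex p)) := {θ | (toCov θ).PosDef}

/-- The space of `p × p` positive definite correlation matrices, an open subset of
`ℝ ^ (p (p - 1) / 2)`. -/
def corSpace (p : ℕ) : Set (EuclideanSpace ℝ (CorIndex p)) := {θ | (toCor θ).PosDef}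

/-- The covariance matrices for which all statements in `I` hold. -/
def covModel {p : ℕ} (I : IndepModel p) : Set (EuclideanSpace ℝ (CovIndex p)) :=
  {θ ∈ covSpace p | ∀ s ∈ I, s.Holds (toCov θ)}

/-- The correlation matrices for which all statements in `I` hold. -/
def corModel {p : ℕ} (I : IndepModel p) : Set (EuclideanSpace ℝ (CorIndex p)) :=
  {θ ∈ corSpace p | ∀ s ∈ I, s.Holds (toCor θ)}

end LocalEquiv

end

/-! For positive definite Σ, the statement i ⫫ j | C is the polynomial equation det Σ_{iC,jC} = 0
(`CIStatement.holds_iff`). At a diagonal matrix its differential is (∏_{c∈C} σ_cc) dσ_ij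
(`eval_pderiv_det_ciMatrix`): to first order C only affects a nonzero factor. By simplicity, each
model is cut out by one such equation per nonadjacent pair (`Param.model_eq_zeroModel`).

(a) With equal adjacencies both models are tangent, at a diagonal matrix, to the same coordinate
subspace. Polynomial charts that differ from the identity by a quadratic error straighten each model
onto this subspace; going from one model to the other through it moves points of the ε-ball by O(ε²)
(`exists_near_point`).

(b) Let the pair e be nonadjacent in the second model only. The equations of the first model, the
second model's equation for e and the remaining coordinates form a square system with Jacobian
determinant h. Where h ≠ 0, the first model has points in the ε-ball at which the equation for e has
size proportional to ε, which excludes 1-equivalence (`IsEquivAt.eval_det_jacobian_eq_zero`). But h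
is a polynomial, nonzero at diagonal matrices. Since I(V) is prime, the part of V where h = 0 has
smaller Krull dimension, and `dimH_realLocus_le` converts this into Hausdorff measure zero. -/

noncomputable section

namespace LocalEquiv

/-! ### Polynomial maps and the inverse function theorem -/

section PolynomialMaps

open MvPolynomial

variable {ι : Type*} [Fintype ι]

/-- The differential at `x` of the function defined by the polynomial `f`. -/
def polyDeriv (f : MvPolynomial ι ℝ) (x : EuclideanSpace ℝ ι) : EuclideanSpace ℝ ι →L[ℝ] ℝ :=
  ∑ j, eval (fun k => x k) (pderiv j f) • EuclideanSpace.proj j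

lemma polyDeriv_apply (f : MvPolynomial ι ℝ) (x v : EuclideanSpace ℝ ι) :
    polyDeriv f x v = ∑ j, eval (fun k => x k) (pderiv j f) * v j := by
  simp [polyDeriv]

lemma hasStrictFDerivAt_eval (f : MvPolynomial ι ℝ) (x : EuclideanSpace ℝ ι) :
    HasStrictFDerivAt (fun y : EuclideanSpace ℝ ι => eval (fun k => y k) f) (polyDeriv f x) x := by
  classical
  induction f using MvPolynomial.induction_on with
  | C a =>
    simp only [eval_C]
    refine (hasStrictFDerivAt_const a x).congr_fderiv ?_
    ext v; simp [polyDeriv_apply]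
  | add p q hp hq =>
    simp only [map_add]
    refine (hp.fun_add hq).congr_fderiv ?_
    ext v; simp [polyDeriv_apply, add_mul, Finset.sum_add_distrib]
  | mul_X p i hp =>
    have hX : HasStrictFDerivAt (fun y : EuclideanSpace ℝ ι => y i)
        (EuclideanSpace.proj i : EuclideanSpace ℝ ι →L[ℝ] ℝ) x :=
      (EuclideanSpace.proj i : EuclideanSpace ℝ ι →L[ℝ] ℝ).hasStrictFDerivAt
    simp only [map_mul, eval_X]
    refine (hp.fun_mul hX).congr_fderiv ?_
    ext v
    simp only [polyDeriv_apply, Derivation.leibniz, pderiv_X, smul_eq_mul, map_add, map_mul,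
      eval_X, add_apply, smul_apply, PiLp.proj_apply, Finset.mul_sum, add_mul,
      Finset.sum_add_distrib]
    congr 1
    · rw [Finset.sum_eq_single i]
      · simp
      · intro j _ hj; simp [hj.symm]
      · simp
    · exact Finset.sum_congr rfl fun j _ => by ring

lemma contDiff_eval (f : MvPolynomial ι ℝ) :
    ContDiff ℝ 2 (fun y : EuclideanSpace ℝ ι => eval (fun k => y k) f) := by
  induction f using MvPolynomial.induction_on with
  | C a => simpa using contDiff_const
  | add p q hp hq => simpa using hp.add hq
  | mul_X p i hp =>
    simp only [map_mul, eval_X]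
    exact hp.mul (EuclideanSpace.proj i : EuclideanSpace ℝ ι →L[ℝ] ℝ).contDiff

/-- The polynomial self-map of Euclidean space with components `G k`. -/
def polyMap (G : ι → MvPolynomial ι ℝ) (x : EuclideanSpace ℝ ι) : EuclideanSpace ℝ ι :=
  WithLp.toLp 2 fun k => eval (fun j => x j) (G k)

@[simp] lemma polyMap_apply (G : ι → MvPolynomial ι ℝ) (x : EuclideanSpace ℝ ι) (k : ι) :
    polyMap G x k = eval (fun j => x j) (G k) := rfl

/-- The Jacobian matrix of a family of polynomials. -/
def jacobian (G : ι → MvPolynomial ι ℝ) : Matrix ι ι (MvPolynomial ι ℝ) :=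
  Matrix.of fun k j => pderiv j (G k)

lemma contDiff_polyMap (G : ι → MvPolynomial ι ℝ) : ContDiff ℝ 2 (polyMap G) :=
  contDiff_euclidean.2 fun k => contDiff_eval (G k)

lemma dimH_coordinate_subspace_le (B : Set ι) :
    dimH {v : EuclideanSpace ℝ ι | ∀ k ∉ B, v k = 0} ≤ B.ncard := by
  classical
  let f : (B → ℝ) → EuclideanSpace ℝ ι := fun w =>
    WithLp.toLp 2 fun k => if h : k ∈ B then w ⟨k, h⟩ else 0
  have hf : ContDiff ℝ 1 f := by
    rw [contDiff_euclidean]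
    intro k
    by_cases h : k ∈ B
    · simpa [f, h] using contDiff_apply ℝ ℝ (⟨k, h⟩ : B)
    · simpa [f, h] using contDiff_const
  refine (dimH_mono ?_).trans (hf.dimH_range_le.trans ?_)
  · intro v hv
    refine ⟨fun k => v k, ?_⟩
    ext k
    by_cases h : k ∈ B
    · simp [f, h]
    · simp [f, h, hv k h]
  · simp [Set.ncard_eq_toFinset_card']

variable [DecidableEq ι]

lemma hasStrictFDerivAt_polyMap (G : ι → MvPolynomial ι ℝ) (x : EuclideanSpace ℝ ι) :
    HasStrictFDerivAt (polyMap G)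
      (Matrix.toEuclideanCLM (𝕜 := ℝ) ((jacobian G).map (eval fun k => x k))) x := by
  rw [hasStrictFDerivAt_euclidean]
  intro k
  refine (hasStrictFDerivAt_eval (G k) x).congr_fderiv ?_
  ext v
  simp [polyDeriv_apply, jacobian, Matrix.mulVec, dotProduct, Matrix.ofLp_toEuclideanCLM]

lemma exists_equiv_hasStrictFDerivAt_polyMap {G : ι → MvPolynomial ι ℝ} {x : EuclideanSpace ℝ ι}
    (h : eval (fun k => x k) (jacobian G).det ≠ 0) :
    ∃ e : EuclideanSpace ℝ ι ≃L[ℝ] EuclideanSpace ℝ ι,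
      HasStrictFDerivAt (polyMap G) (e : EuclideanSpace ℝ ι →L[ℝ] EuclideanSpace ℝ ι) x := by
  set A := (jacobian G).map (eval fun k => x k) with hA
  have hdet : IsUnit A := by
    rw [Matrix.isUnit_iff_isUnit_det]
    have : A.det = eval (fun k => x k) (jacobian G).det := by
      rw [RingHom.map_det]; rfl
    rw [this]; exact h.isUnit
  have hu : IsUnit (Matrix.toEuclideanCLM (𝕜 := ℝ) A) := hdet.map _
  refine ⟨ContinuousLinearEquiv.unitsEquiv ℝ _ hu.unit, ?_⟩
  refine (hasStrictFDerivAt_polyMap G x).congr_fderiv ?_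
  rfl

/-- Inverse function theorem with a linear bound: the local inverse is Lipschitz, so preimages stay
at a distance controlled by the displacement of the target. -/
lemma polyMap_locally_surjective {G : ι → MvPolynomial ι ℝ} {x : EuclideanSpace ℝ ι}
    (h : eval (fun k => x k) (jacobian G).det ≠ 0) :
    ∃ K : ℝ, 0 < K ∧ ∀ᶠ v in 𝓝 (polyMap G x),
      ∃ y, polyMap G y = v ∧ dist y x ≤ K * dist v (polyMap G x) := by
  obtain ⟨e, he⟩ := exists_equiv_hasStrictFDerivAt_polyMap h
  obtain ⟨K, s, hs, hK⟩ := he.to_localInverse.exists_lipschitzOnWith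
  have hx : he.localInverse _ _ _ (polyMap G x) = x := he.eventually_left_inverse.self_of_nhds
  refine ⟨K + 1, by positivity, ?_⟩
  filter_upwards [he.eventually_right_inverse, hs] with v hv hvs
  refine ⟨_, hv, ?_⟩
  calc dist (he.localInverse _ _ _ v) x
      = dist (he.localInverse _ _ _ v) (he.localInverse _ _ _ (polyMap G x)) := by rw [hx]
    _ ≤ K * dist v (polyMap G x) := hK.dist_le_mul _ hvs _ (mem_of_mem_nhds hs)
    _ ≤ (K + 1) * dist v (polyMap G x) := by gcongr; linarith

/-- The map `polyMap G` sends `S` into a coordinate subspace; near `x`, the set `S` is recovered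
from it by the Lipschitz local inverse, which cannot raise Hausdorff dimension. -/
lemma exists_nhds_dimH_le {G : ι → MvPolynomial ι ℝ} {x : EuclideanSpace ℝ ι} {B : Set ι}
    {S : Set (EuclideanSpace ℝ ι)} (hS : ∀ y ∈ S, ∀ k ∉ B, eval (fun j => y j) (G k) = 0)
    (h : eval (fun k => x k) (jacobian G).det ≠ 0) :
    ∃ U ∈ 𝓝 x, dimH (S ∩ U) ≤ B.ncard := by
  obtain ⟨e, he⟩ := exists_equiv_hasStrictFDerivAt_polyMap h
  obtain ⟨K, s, hs, hK⟩ := he.to_localInverse.exists_lipschitzOnWith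
  refine ⟨{y | he.localInverse _ _ _ (polyMap G y) = y} ∩ polyMap G ⁻¹' s,
    inter_mem he.eventually_left_inverse (he.continuousAt hs), ?_⟩
  calc dimH _ ≤ dimH (he.localInverse _ _ _ '' ({v | ∀ k ∉ B, v k = 0} ∩ s)) := by
        refine dimH_mono ?_
        rintro y ⟨hy, hy1, hy2⟩
        exact ⟨polyMap G y, ⟨fun k hk => hS y hy k hk, hy2⟩, hy1⟩
    _ ≤ dimH ({v : EuclideanSpace ℝ ι | ∀ k ∉ B, v k = 0} ∩ s) :=
        (hK.mono Set.inter_subset_right).dimH_image_le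
    _ ≤ _ := (dimH_mono Set.inter_subset_left).trans (dimH_coordinate_subspace_le B)

/-- The derivative of `polyMap G - id` vanishes at `x` and is Lipschitz nearby, so the mean value
inequality on the closed ball of radius `dist y x` gives a quadratic bound. This is the source of
the exponent 2. -/
lemma norm_polyMap_sub_self_le {G : ι → MvPolynomial ι ℝ} {x : EuclideanSpace ℝ ι}
    (hx : polyMap G x = x) (h : (jacobian G).map (eval fun k => x k) = 1) :
    ∃ C : ℝ, 0 < C ∧ ∀ᶠ y in 𝓝 x, dist (polyMap G y) y ≤ C * dist y x ^ 2 := by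
  have hG := contDiff_polyMap G
  have hD : ContDiff ℝ 1 (fun y => fderiv ℝ (polyMap G) y) :=
    hG.fderiv_right (by norm_num)
  obtain ⟨K, s, hs, hK⟩ := hD.contDiffAt.exists_lipschitzOnWith (x := x)
  obtain ⟨r, hr, hrs⟩ := Metric.mem_nhds_iff.1 hs
  have hdx : fderiv ℝ (polyMap G) x = ContinuousLinearMap.id ℝ _ := by
    rw [(hasStrictFDerivAt_polyMap G x).hasFDerivAt.fderiv, h]
    ext; simp
  refine ⟨K + 1, by positivity, ?_⟩
  filter_upwards [Metric.ball_mem_nhds x hr] with y hy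
  have key : ‖(polyMap G y - y) - (polyMap G x - x)‖ ≤ (K * dist y x) * ‖y - x‖ := by
    refine (convex_closedBall x (dist y x)).norm_image_sub_le_of_norm_hasFDerivWithin_le
      (f := fun z => polyMap G z - z)
      (f' := fun z => fderiv ℝ (polyMap G) z - ContinuousLinearMap.id ℝ _) (fun z hz => ?_)
      (fun z hz => ?_) (by simp [dist_nonneg]) (by simp)
    · exact (((hG.differentiable (by norm_num)).differentiableAt.hasFDerivAt).sub
        (hasFDerivAt_id z)).hasFDerivWithinAt
    · have hz' : z ∈ s := hrs (lt_of_le_of_lt (Metric.mem_closedBall.1 hz) hy)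
      have := hK.dist_le_mul z hz' x (mem_of_mem_nhds hs)
      rw [dist_eq_norm, hdx] at this
      refine this.trans ?_
      gcongr
      exact Metric.mem_closedBall.1 hz
  rw [hx, sub_self, sub_zero, ← dist_eq_norm, ← dist_eq_norm] at key
  nlinarith [sq_nonneg (dist y x)]

end PolynomialMaps

/-! ### Comparing zero sets near a point -/

section ZeroModels

open MvPolynomial

variable {ι : Type*} [Fintype ι]

/-- The subset of `Θ` on which the polynomials `g e` with `e ∈ N` vanish. -/
def zeroModel (Θ : Set (EuclideanSpace ℝ ι)) (N : Set ι) (g : ι → MvPolynomial ι ℝ) :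
    Set (EuclideanSpace ℝ ι) :=
  {θ ∈ Θ | ∀ e ∈ N, eval (fun k => θ k) (g e) = 0}

/-- At `θ₀`, each polynomial `g e` with `e ∈ N` agrees to first order with a nonzero multiple of
the coordinate `e`, which vanishes at `θ₀`. -/
structure IsAdapted (N : Set ι) (g : ι → MvPolynomial ι ℝ) (θ₀ : EuclideanSpace ℝ ι) : Prop where
  coord : ∀ e ∈ N, θ₀ e = 0
  eval_eq_zero : ∀ e ∈ N, eval (fun k => θ₀ k) (g e) = 0
  pderiv_self : ∀ e ∈ N, eval (fun k => θ₀ k) (pderiv e (g e)) ≠ 0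
  pderiv_of_ne : ∀ e ∈ N, ∀ k, k ≠ e → eval (fun k => θ₀ k) (pderiv k (g e)) = 0

lemma IsAdapted.mem_zeroModel {Θ : Set (EuclideanSpace ℝ ι)} {N : Set ι}
    {g : ι → MvPolynomial ι ℝ} {θ₀ : EuclideanSpace ℝ ι} (hg : IsAdapted N g θ₀) (hθ : θ₀ ∈ Θ) :
    θ₀ ∈ zeroModel Θ N g :=
  ⟨hθ, hg.eval_eq_zero⟩

variable [DecidableEq ι]

/-- A polynomial chart that straightens a model around a point to which it is adapted. -/
lemma IsAdapted.exists_chart {N : Set ι} {g : ι → MvPolynomial ι ℝ} {θ₀ : EuclideanSpace ℝ ι}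
    (hg : IsAdapted N g θ₀) :
    ∃ G : ι → MvPolynomial ι ℝ, polyMap G θ₀ = θ₀ ∧
      (jacobian G).map (eval fun k => θ₀ k) = 1 ∧
      ∀ x : EuclideanSpace ℝ ι, ∀ e ∈ N,
        (eval (fun k => x k) (G e) = 0 ↔ eval (fun k => x k) (g e) = 0) := by
  classical
  -- Dividing `g e` by its own partial derivative at `θ₀` makes the Jacobian there the identity.
  refine ⟨fun e => if e ∈ N then C (eval (fun k => θ₀ k) (pderiv e (g e)))⁻¹ * g e else X e,
    ?_, ?_, ?_⟩
  · ext e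
    by_cases he : e ∈ N
    · simp [he, hg.eval_eq_zero, hg.coord]
    · simp [he]
  · ext e k
    by_cases he : e ∈ N
    · rcases eq_or_ne k e with rfl | hk
      · simp [jacobian, he, hg.pderiv_self]
      · simp [jacobian, he, hg.pderiv_of_ne e he k hk, Matrix.one_apply_ne hk.symm]
    · rcases eq_or_ne k e with rfl | hk
      · simp [jacobian, he]
      · simp [jacobian, he, Matrix.one_apply_ne hk.symm, pderiv_X_of_ne hk.symm]
  · intro x e he
    simp [he, hg.pderiv_self]

/-- The point `F₂⁻¹ (F₁ x)` lies on the second model within O(ε²) of `x`, but may leave the open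
ε-ball. Contracting `F₁ x` towards `θ₀` by `1 - A * ε` first costs only another O(ε²), keeps the
coordinates in `N` zero, and makes room for both chart errors. -/
lemma exists_near_point {Θ : Set (EuclideanSpace ℝ ι)} {N : Set ι}
    {g₁ g₂ : ι → MvPolynomial ι ℝ} {θ₀ : EuclideanSpace ℝ ι} (hΘ : Θ ∈ 𝓝 θ₀)
    (h₁ : IsAdapted N g₁ θ₀) (h₂ : IsAdapted N g₂ θ₀) :
    ∃ A : ℝ, ∀ᶠ ε in 𝓝[>] (0 : ℝ), ∀ x ∈ zeroModel Θ N g₁ ∩ Metric.ball θ₀ ε,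
      ∃ y ∈ zeroModel Θ N g₂ ∩ Metric.ball θ₀ ε, dist x y ≤ A * ε ^ 2 := by
  obtain ⟨F₁, hF₁, hJ₁, hz₁⟩ := h₁.exists_chart
  obtain ⟨F₂, hF₂, hJ₂, hz₂⟩ := h₂.exists_chart
  obtain ⟨C₁, hC₁, hq₁⟩ := norm_polyMap_sub_self_le hF₁ hJ₁
  obtain ⟨C₂, hC₂, hq₂⟩ := norm_polyMap_sub_self_le hF₂ hJ₂
  have hdet : eval (fun k => θ₀ k) (jacobian F₂).det ≠ 0 := by
    rw [RingHom.map_det, RingHom.mapMatrix_apply, hJ₂]; simp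
  obtain ⟨K, hK, hs⟩ := polyMap_locally_surjective hdet
  rw [hF₂] at hs
  obtain ⟨r, hr, hball⟩ := Metric.mem_nhds_iff.1 (inter_mem (inter_mem hq₁ hq₂) (inter_mem hΘ hs))
  -- Since `dist y θ₀ ≤ 2 * K * ε`, the error of the second chart at `y` is at most `B * ε ^ 2`; the
  -- first chart's is at most `C₁ * ε ^ 2`. The contraction gains `A * ε ^ 2`, so `A = C₁ + B`
  -- balances them.
  set B := 4 * K ^ 2 * C₂ with hB
  have hBpos : 0 < B := by positivity
  set A := C₁ + B with hA
  have hApos : 0 < A := by positivity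
  have ev : ∀ c : ℝ, 0 < c → ∀ᶠ ε in 𝓝[>] (0 : ℝ), ε < c := fun c hc =>
    (eventually_lt_nhds hc).filter_mono nhdsWithin_le_nhds
  refine ⟨C₁ + 2 * A + B, ?_⟩
  filter_upwards [self_mem_nhdsWithin, ev r hr, ev (r / 2) (by positivity),
    ev (r / (2 * K)) (by positivity), ev (1 / (2 * A)) (by positivity),
    ev (1 / C₁) (by positivity)] with ε (hε : 0 < ε) e1 e2 e3 e4 e5 x hx
  rw [lt_div_iff₀ (by positivity)] at e2 e3 e4 e5
  obtain ⟨⟨-, hxN⟩, hxb⟩ := hx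
  have hxε : dist x θ₀ < ε := hxb
  have hx1 : dist (polyMap F₁ x) x ≤ C₁ * dist x θ₀ ^ 2 :=
    (hball (Metric.mem_ball.2 (hxε.trans e1))).1.1
  have hx2 : dist (polyMap F₁ x) x ≤ C₁ * ε ^ 2 := hx1.trans (by gcongr)
  set u := polyMap F₁ x - θ₀ with hu
  have hun : ‖u‖ ≤ dist x θ₀ + C₁ * ε ^ 2 := by
    rw [hu, ← dist_eq_norm]
    linarith [dist_triangle (polyMap F₁ x) x θ₀]
  have hun2 : ‖u‖ < 2 * ε := by nlinarith
  set v := θ₀ + (1 - A * ε) • u with hv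
  have hAε : 0 < 1 - A * ε := by nlinarith
  have hvd : dist v θ₀ = (1 - A * ε) * ‖u‖ := by
    rw [hv, dist_eq_norm, add_sub_cancel_left, norm_smul, Real.norm_of_nonneg hAε.le]
  have hvd2 : dist v θ₀ ≤ 2 * ε := by
    rw [hvd]
    have : 0 ≤ A * ε * ‖u‖ := by positivity
    nlinarith
  obtain ⟨y, hy, hyd⟩ : ∃ y, polyMap F₂ y = v ∧ dist y θ₀ ≤ K * dist v θ₀ :=
    (hball (Metric.mem_ball.2 (by linarith))).2.2
  have hyd2 : dist y θ₀ ≤ 2 * K * ε := by nlinarith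
  have hyr : y ∈ Metric.ball θ₀ r := Metric.mem_ball.2 (by nlinarith)
  have hyv : dist v y ≤ B * ε ^ 2 := by
    have h := (hball hyr).1.2
    simp only [Set.mem_setOf_eq, hy] at h
    refine h.trans ?_
    calc C₂ * dist y θ₀ ^ 2 ≤ C₂ * (2 * K * ε) ^ 2 := by gcongr
      _ = B * ε ^ 2 := by rw [hB]; ring
  refine ⟨y, ⟨⟨(hball hyr).2.1, fun e he => ?_⟩, ?_⟩, ?_⟩
  · rw [← hz₂ y e he, ← polyMap_apply, hy]
    have h1 : eval (fun k => x k) (F₁ e) = 0 := (hz₁ x e he).2 (hxN e he)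
    simp [hv, hu, h1, h₁.coord e he]
  · rw [Metric.mem_ball]
    have h1 : dist y θ₀ ≤ B * ε ^ 2 + (1 - A * ε) * ‖u‖ := by
      rw [← hvd]
      linarith [dist_triangle y v θ₀, dist_comm y v]
    have h2 : (1 - A * ε) * ‖u‖ < (1 - A * ε) * (ε + C₁ * ε ^ 2) := by
      gcongr; linarith
    have h3 : 0 ≤ A * C₁ * ε ^ 3 := by positivity
    have h4 : (1 - A * ε) * (ε + C₁ * ε ^ 2) = ε - A * ε ^ 2 + C₁ * ε ^ 2 - A * C₁ * ε ^ 3 := by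
      ring
    have h5 : A * ε ^ 2 = C₁ * ε ^ 2 + B * ε ^ 2 := by rw [hA]; ring
    linarith
  · have h1 : dist (polyMap F₁ x) v = A * ε * ‖u‖ := by
      have : polyMap F₁ x - v = (A * ε) • u := by rw [hv, hu]; module
      rw [dist_eq_norm, this, norm_smul, Real.norm_of_nonneg (by positivity)]
    have h2 : A * ε * ‖u‖ ≤ A * ε * (2 * ε) := by gcongr
    have h3 := dist_triangle4 x (polyMap F₁ x) v y
    rw [dist_comm x (polyMap F₁ x)] at h3
    nlinarith

lemma isNearEquivAt_zeroModel {Θ : Set (EuclideanSpace ℝ ι)} {N : Set ι}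
    {g₁ g₂ : ι → MvPolynomial ι ℝ} {θ₀ : EuclideanSpace ℝ ι} (hΘ : Θ ∈ 𝓝 θ₀)
    (h₁ : IsAdapted N g₁ θ₀) (h₂ : IsAdapted N g₂ θ₀) :
    IsNearEquivAt 2 (zeroModel Θ N g₁) (zeroModel Θ N g₂) θ₀ := by
  refine ⟨⟨h₁.mem_zeroModel (mem_of_mem_nhds hΘ), h₂.mem_zeroModel (mem_of_mem_nhds hΘ)⟩, ?_⟩
  obtain ⟨A, hA⟩ := exists_near_point hΘ h₁ h₂
  obtain ⟨B, hB⟩ := exists_near_point hΘ h₂ h₁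
  -- No sign is known for `A` and `B`, and the bound must be nonnegative even if it is never
  -- attained: hence the `0`.
  refine IsBigO.of_bound (max 0 (max A B)) ?_
  filter_upwards [hA, hB] with ε h1 h2
  rw [Real.norm_of_nonneg Metric.hausdorffDist_nonneg, Real.rpow_two, Real.norm_of_nonneg (by positivity)]
  refine Metric.hausdorffDist_le_of_mem_dist (by positivity) (fun x hx => ?_) (fun x hx => ?_)
  · obtain ⟨y, hy, hd⟩ := h1 x hx
    exact ⟨y, hy, hd.trans (by gcongr; exact (le_max_left _ _).trans (le_max_right _ _))⟩
  · obtain ⟨y, hy, hd⟩ := h2 x hx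
    exact ⟨y, hy, hd.trans (by gcongr; exact (le_max_right _ _).trans (le_max_right _ _))⟩

lemma IsEquivAt.symm {c : ℝ} {M₁ M₂ : Set (EuclideanSpace ℝ ι)} {θ : EuclideanSpace ℝ ι}
    (h : IsEquivAt c M₁ M₂ θ) : IsEquivAt c M₂ M₁ θ :=
  ⟨h.1.symm, by simpa only [Metric.hausdorffDist_comm] using h.2⟩

/-- The equations of the model for `N` together with one further equation `f` at the place of the
coordinate `e`, completed by coordinates. -/
def augment (N : Set ι) (g : ι → MvPolynomial ι ℝ) (e : ι) (f : MvPolynomial ι ℝ) :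
    ι → MvPolynomial ι ℝ := by
  classical
  exact fun k => if k ∈ N then g k else if k = e then f else X k

/-- Each row is, at `θ₀`, a nonzero multiple of its own coordinate differential, so the Jacobian is
diagonal and invertible. This shows that the determinant does not vanish identically on a model
through `θ₀`. -/
lemma eval_det_jacobian_augment_ne_zero {N₁ N₂ : Set ι} {g₁ g₂ : ι → MvPolynomial ι ℝ}
    {θ₀ : EuclideanSpace ℝ ι} (h₁ : IsAdapted N₁ g₁ θ₀) (h₂ : IsAdapted N₂ g₂ θ₀) {e : ι}
    (he : e ∈ N₂) :
    eval (fun k => θ₀ k) (jacobian (augment N₁ g₁ e (g₂ e))).det ≠ 0 := by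
  classical
  rw [RingHom.map_det, RingHom.mapMatrix_apply]
  have : (jacobian (augment N₁ g₁ e (g₂ e))).map (eval fun k => θ₀ k) =
      Matrix.diagonal fun k =>
        eval (fun k => θ₀ k) (pderiv k (augment N₁ g₁ e (g₂ e) k)) := by
    ext k j
    rcases eq_or_ne k j with rfl | hj
    · simp [jacobian]
    · rw [Matrix.diagonal_apply_ne _ hj]
      by_cases hk : k ∈ N₁
      · simp [jacobian, augment, hk, h₁.pderiv_of_ne k hk j hj.symm]
      · by_cases hke : k = e
        · subst hke
          simp [jacobian, augment, hk, h₂.pderiv_of_ne k he j hj.symm]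
        · simp [jacobian, augment, hk, hke, pderiv_X_of_ne hj]
  rw [this, Matrix.det_diagonal, Finset.prod_ne_zero_iff]
  intro k _
  by_cases hk : k ∈ N₁
  · simp [augment, hk, h₁.pderiv_self k hk]
  · by_cases hke : k = e
    · subst hke
      simp [augment, hk, h₂.pderiv_self k he]
    · simp [augment, hk, hke]

/-- If the determinant were nonzero, one could move inside the first model so that `g₂ e` grows
linearly in ε. As `g₂ e` is Lipschitz near `θ` and zero on the second model, the Hausdorff distance
would be at least a multiple of ε. -/
lemma IsEquivAt.eval_det_jacobian_eq_zero {Θ : Set (EuclideanSpace ℝ ι)} {N₁ N₂ : Set ι}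
    {g₁ g₂ : ι → MvPolynomial ι ℝ} {θ : EuclideanSpace ℝ ι} (hΘ : Θ ∈ 𝓝 θ) {e : ι}
    (he₁ : e ∉ N₁) (he₂ : e ∈ N₂)
    (h : IsEquivAt 1 (zeroModel Θ N₁ g₁) (zeroModel Θ N₂ g₂) θ) :
    eval (fun k => θ k) (jacobian (augment N₁ g₁ e (g₂ e))).det = 0 := by
  classical
  by_contra hdet
  obtain ⟨⟨hθ₁, hθ₂⟩, ho⟩ := h
  set H := augment N₁ g₁ e (g₂ e) with hH
  obtain ⟨K, hK, hs⟩ := polyMap_locally_surjective hdet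
  obtain ⟨L, s, hsn, hL⟩ :=
    ((contDiff_eval (g₂ e)).of_le (by norm_num)).contDiffAt.exists_lipschitzOnWith (x := θ)
  obtain ⟨r, hr, hball⟩ := Metric.mem_nhds_iff.1 (inter_mem hΘ hsn)
  -- The shift `ε / (2 * K)` makes the preimage land within `ε / 2` of `θ`.
  have hlim : Tendsto (fun ε : ℝ => polyMap H θ + (ε / (2 * K)) • EuclideanSpace.single e (1 : ℝ))
      (𝓝[>] 0) (𝓝 (polyMap H θ)) := by
    have hc : Continuous fun ε : ℝ => polyMap H θ + (ε / (2 * K)) • EuclideanSpace.single e (1 : ℝ) := by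
      fun_prop
    have h0 := (hc.tendsto 0).mono_left (nhdsWithin_le_nhds (s := Set.Ioi 0))
    simpa using h0
  -- Times ε this is `t / (2 * (L + 1))` with `t = ε / (2 * K)`, strictly below the value `t / (L +
  -- 1)` that contradicts the Lipschitz bound.
  have hc : 0 < 1 / (4 * K * (L + 1)) := by positivity
  obtain ⟨ε, ⟨⟨y, hy, hyd⟩, hD⟩, hε, hεr⟩ := (((hlim.eventually hs).and (ho.bound hc)).and
    ((eventually_mem_nhdsWithin (a := (0 : ℝ)) (s := Set.Ioi 0)).and
      ((eventually_lt_nhds hr).filter_mono nhdsWithin_le_nhds))).exists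
  replace hε : 0 < ε := hε
  set t := ε / (2 * K) with ht
  have htpos : 0 < t := by positivity
  have hεt : ε = 2 * K * t := by rw [ht]; field_simp
  have hyd' : dist y θ ≤ K * t := by
    simpa [norm_smul, abs_of_pos htpos] using hyd
  have hyε : y ∈ Metric.ball θ ε := Metric.mem_ball.2 (by nlinarith [mul_pos hK htpos])
  have hyΘ := hball (Metric.ball_subset_ball hεr.le hyε)
  have hy₁ : y ∈ zeroModel Θ N₁ g₁ := by
    refine ⟨hyΘ.1, fun k hk => ?_⟩
    have hke : k ≠ e := fun h => he₁ (h ▸ hk)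
    have h1 := congrArg (fun z : EuclideanSpace ℝ ι => z k) hy
    simpa [hH, augment, hk, hθ₁.2 k hk, hke] using h1
  have hye : eval (fun k => y k) (g₂ e) = t := by
    have h1 := congrArg (fun z : EuclideanSpace ℝ ι => z e) hy
    simpa [hH, augment, he₁, hθ₂.2 e he₂] using h1
  rw [Real.norm_of_nonneg Metric.hausdorffDist_nonneg, Real.rpow_one,
    Real.norm_of_nonneg hε.le] at hD
  have hD' : Metric.hausdorffDist (zeroModel Θ N₁ g₁ ∩ Metric.ball θ ε)
      (zeroModel Θ N₂ g₂ ∩ Metric.ball θ ε) < t / (L + 1) := by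
    refine hD.trans_lt ?_
    rw [hεt, div_mul_eq_mul_div, div_lt_div_iff₀ (by positivity) (by positivity)]
    have : 0 < K * t * (L + 1) := by positivity
    nlinarith
  obtain ⟨z, hz, hyz⟩ := Metric.exists_dist_lt_of_hausdorffDist_lt (Set.mem_inter hy₁ hyε) hD'
    (Metric.hausdorffEDist_ne_top_of_nonempty_of_bounded ⟨θ, hθ₁, Metric.mem_ball_self hε⟩
      ⟨θ, hθ₂, Metric.mem_ball_self hε⟩ (Metric.isBounded_ball.subset Set.inter_subset_right)
      (Metric.isBounded_ball.subset Set.inter_subset_right))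
  have hLz := hL.dist_le_mul y hyΘ.2 z (hball (Metric.ball_subset_ball hεr.le hz.2)).2
  rw [hye, hz.1.2 e he₂, dist_zero_right, Real.norm_of_nonneg htpos.le] at hLz
  rw [lt_div_iff₀ (by positivity)] at hyz
  nlinarith [dist_nonneg (x := y) (y := z)]

end ZeroModels

/-! ### Krull dimension bounds Hausdorff dimension -/

section Dimension

open MvPolynomial

/-- Lying over and going up lift every chain of primes of `R` to `S`. -/
lemma ringKrullDim_le_of_isIntegral (R S : Type*) [CommRing R] [CommRing S] [Algebra R S]
    [Algebra.IsIntegral R S] [FaithfulSMul R S] : ringKrullDim R ≤ ringKrullDim S := by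
  have : Algebra.HasGoingUp R S := ⟨fun {q} _ P _ hPq => by
    obtain ⟨Q, hPQ, hQ, hc⟩ := Ideal.exists_ideal_over_prime_of_isIntegral_of_isPrime q P hPq.le
    exact ⟨Q, hPQ, hQ, ⟨hc.symm⟩⟩⟩
  refine iSup_le fun l => ?_
  obtain ⟨⟨P, hP, hl⟩⟩ := Ideal.nonempty_primesOver (S := S) l.head.asIdeal
  obtain ⟨L, hL, -⟩ := Ideal.exists_ltSeries_of_hasGoingUp (S := S) l P
  rw [← hL]
  exact Order.LTSeries.length_le_krullDim L

/-- By Noether normalization `A` is integral over a polynomial ring in `s` variables: then the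
transcendence degree is at most `s`, and `s` is at most the Krull dimension. -/
lemma card_le_ringKrullDim_of_algebraicIndependent {k A τ : Type*} [Field k] [CommRing A]
    [IsDomain A] [Algebra k A] [Algebra.FiniteType k A] [Fintype τ] {v : τ → A}
    (hv : AlgebraicIndependent k v) : (Fintype.card τ : WithBot ℕ∞) ≤ ringKrullDim A := by
  obtain ⟨s, g, hg, hint⟩ := exists_integral_inj_algHom_of_fg k A
  have hcard : Fintype.card τ ≤ s := by
    have halg : Algebra.IsAlgebraic (Algebra.adjoin k (Set.range fun i => g (X i))) A := by
      refine ⟨fun a => IsIntegral.isAlgebraic ?_⟩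
      have hrange : g.range = Algebra.adjoin k (Set.range fun i => g (X i)) := by
        rw [← Algebra.map_top, ← adjoin_range_X, AlgHom.map_adjoin, ← Set.range_comp]
        rfl
      rw [← hrange]
      obtain ⟨p, hp, hp0⟩ := hint a
      refine ⟨p.map g.rangeRestrict.toRingHom, hp.map _, ?_⟩
      rw [Polynomial.eval₂_map]
      exact hp0
    have h1 := hv.lift_cardinalMk_le_trdeg
    have h2 := Algebra.IsAlgebraic.trdeg_le_cardinalMk k (Set.range fun i => g (X i))
    have h3 : Cardinal.mk (Set.range fun i => g (X i)) ≤ s := by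
      have := Fintype.ofFinite (Set.range fun i => g (X i))
      rw [Cardinal.mk_fintype]
      exact_mod_cast (Fintype.card_le_of_surjective _ Set.rangeFactorization_surjective).trans_eq
        (Fintype.card_fin s)
    have h4 := h1.trans (Cardinal.lift_le.2 (h2.trans h3))
    simpa using h4
  let _ := g.toRingHom.toAlgebra
  have : Algebra.IsIntegral (MvPolynomial (Fin s) k) A := ⟨hint⟩
  have : FaithfulSMul (MvPolynomial (Fin s) k) A :=
    (faithfulSMul_iff_algebraMap_injective _ _).2 hg
  have h := ringKrullDim_le_of_isIntegral (MvPolynomial (Fin s) k) A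
  rw [MvPolynomial.ringKrullDim_of_isNoetherianRing, ringKrullDim_eq_zero_of_field, zero_add,
    Nat.card_fin] at h
  exact le_trans (by exact_mod_cast hcard) h

/-- Take a nonzero annihilating polynomial of least degree. In characteristic zero its derivative is
nonzero of smaller degree, hence cannot annihilate `a`. -/
lemma exists_aeval_derivative_ne_zero {R A : Type*} [CommRing R] [IsDomain R] [CharZero R]
    [CommRing A] [Algebra R A] [FaithfulSMul R A] {a : A} (ha : IsAlgebraic R a) :
    ∃ q : Polynomial R, Polynomial.aeval a q = 0 ∧
      Polynomial.aeval a (Polynomial.derivative q) ≠ 0 := by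
  classical
  have hex : ∃ n, ∃ q : Polynomial R, q ≠ 0 ∧ Polynomial.aeval a q = 0 ∧ q.natDegree = n := by
    obtain ⟨q, hq, hq0⟩ := ha
    exact ⟨_, q, hq, hq0, rfl⟩
  obtain ⟨q, hq, hq0, hn⟩ := Nat.find_spec hex
  refine ⟨q, hq0, fun hd => ?_⟩
  have hdeg : q.natDegree ≠ 0 := by
    intro h0
    rw [Polynomial.eq_C_of_natDegree_eq_zero h0, Polynomial.aeval_C,
      FaithfulSMul.algebraMap_eq_zero_iff] at hq0
    apply hq
    rw [Polynomial.eq_C_of_natDegree_eq_zero h0, hq0, Polynomial.C_0]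
  have hd0 : Polynomial.derivative q ≠ 0 := by
    intro h0
    exact hdeg (Polynomial.derivative_eq_zero.1 h0)
  refine Nat.find_min hex ?_ ⟨_, hd0, hd, rfl⟩
  rw [← hn]
  exact Polynomial.natDegree_derivative_lt hdeg

/-- The coefficients involve only variables in the range of `r`, so `pderiv j` treats them as
constants and only the chain rule in `X k` remains. -/
lemma pderiv_eval₂_rename {ι τ : Type*} (r : τ → ι) (k j : ι) (hj : ∀ a, r a ≠ j)
    (q : Polynomial (MvPolynomial τ ℝ)) :
    pderiv j (q.eval₂ (rename r : MvPolynomial τ ℝ →ₐ[ℝ] MvPolynomial ι ℝ).toRingHom (X k)) =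
      (Polynomial.derivative q).eval₂
        (rename r : MvPolynomial τ ℝ →ₐ[ℝ] MvPolynomial ι ℝ).toRingHom (X k) *
          pderiv j (X k) := by
  classical
  have hren : ∀ c : MvPolynomial τ ℝ, pderiv j (rename r c) = 0 := by
    intro c
    refine pderiv_eq_zero_of_notMem_vars fun hc => ?_
    obtain ⟨a, -, ha⟩ := Finset.mem_image.1 (vars_rename r c hc)
    exact hj a ha
  induction q using Polynomial.induction_on' with
  | add p q hp hq => simp only [Polynomial.eval₂_add, map_add, hp, hq, add_mul]
  | monomial n c =>
    simp only [Polynomial.eval₂_monomial, Polynomial.derivative_monomial, Derivation.leibniz,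
      Derivation.leibniz_pow, AlgHom.toRingHom_eq_coe, RingHom.coe_coe, hren, map_mul,
      map_natCast, smul_eq_mul, nsmul_eq_mul]
    ring

variable {ι : Type*} [Fintype ι]

/-- The real zero locus of an ideal, as a subset of Euclidean space. -/
def realLocus (I : Ideal (MvPolynomial ι ℝ)) : Set (EuclideanSpace ℝ ι) :=
  {x | ∀ f ∈ I, eval (fun k => x k) f = 0}

/-- Let `B` index coordinates whose classes form a transcendence basis of the quotient. Every other
coordinate is algebraic over them, and its equation, separable in the sense of
`exists_aeval_derivative_ne_zero`, involves only that coordinate and those in `B`. -/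
lemma exists_generic_equations (I : Ideal (MvPolynomial ι ℝ)) [hI : I.IsPrime] {n : ℕ}
    (hn : ringKrullDim (MvPolynomial ι ℝ ⧸ I) ≤ n) :
    ∃ (B : Set ι) (g : ι → MvPolynomial ι ℝ), B.ncard ≤ n ∧
      ∀ k ∉ B, g k ∈ I ∧ pderiv k (g k) ∉ I ∧ ∀ j ∉ B, j ≠ k → pderiv j (g k) = 0 := by
  classical
  set A := MvPolynomial ι ℝ ⧸ I
  have hsurj := Ideal.Quotient.mkₐ_surjective ℝ I
  set π := Ideal.Quotient.mkₐ ℝ I with hπ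
  have hπI : ∀ f, π f = 0 ↔ f ∈ I := fun f => Ideal.Quotient.eq_zero_iff_mem
  have htop : Algebra.adjoin ℝ (Set.range fun k => π (X k)) = ⊤ := by
    have : (Set.range fun k => π (X k)) = π '' Set.range X := by rw [← Set.range_comp]; rfl
    rw [this, ← AlgHom.map_adjoin, adjoin_range_X, Algebra.map_top]
    exact (AlgHom.range_eq_top _).2 hsurj
  have halg : Algebra.IsAlgebraic (Algebra.adjoin ℝ (Set.range fun k => π (X k))) A := by
    refine ⟨fun a => ?_⟩
    have ha : a ∈ Algebra.adjoin ℝ (Set.range fun k => π (X k)) := by rw [htop]; trivial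
    exact isAlgebraic_algebraMap (⟨a, ha⟩ : Algebra.adjoin ℝ (Set.range fun k => π (X k)))
  have : FaithfulSMul ℝ A :=
    (faithfulSMul_iff_algebraMap_injective ℝ A).2 (algebraMap ℝ A).injective
  obtain ⟨t, ht, hbasis⟩ := exists_isTranscendenceBasis_subset (R := ℝ)
    (Set.range fun k => π (X k))
  choose r hr using fun a : t => ht a.2
  have hrinj : Function.Injective r := fun a b hab => Subtype.ext (by rw [← hr a, ← hr b, hab])
  have : Finite t := Finite.of_injective r hrinj
  have := Fintype.ofFinite t
  have hcard := (card_le_ringKrullDim_of_algebraicIndependent hbasis.1).trans hn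
  have halg' := hbasis.isAlgebraic
  set S := Algebra.adjoin ℝ (Set.range (Subtype.val : t → A))
  let ρ : MvPolynomial t ℝ →ₐ[ℝ] MvPolynomial ι ℝ := rename r
  let σ : MvPolynomial t ℝ ≃ₐ[ℝ] S := hbasis.1.aevalEquiv
  have hcomp : π.toRingHom.comp ρ.toRingHom = (algebraMap S A).comp σ.toRingEquiv.toRingHom := by
    refine RingHom.ext fun c => ?_
    have h1 : π.comp ρ = aeval Subtype.val := by
      refine algHom_ext fun a => ?_
      simpa [ρ] using hr a
    exact (DFunLike.congr_fun h1 c).trans (hbasis.1.algebraMap_aevalEquiv c).symm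
  have : CharZero S :=
    charZero_of_injective_algebraMap (algebraMap ℝ S).injective
  have key : ∀ k : ι, ∃ g : MvPolynomial ι ℝ, k ∉ Set.range r →
      g ∈ I ∧ pderiv k g ∉ I ∧ ∀ j ∉ Set.range r, j ≠ k → pderiv j g = 0 := by
    intro k
    obtain ⟨p, hp0, hp1⟩ := exists_aeval_derivative_ne_zero (halg'.isAlgebraic (π (X k)))
    -- The basis is algebraically independent, so the coefficients of `p` lift to genuine
    -- polynomials in the coordinates of `B`.
    obtain ⟨q, rfl⟩ := Polynomial.map_surjective σ.toRingEquiv.toRingHom σ.surjective p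
    have hev : ∀ q' : Polynomial (MvPolynomial t ℝ), π (q'.eval₂ ρ.toRingHom (X k)) =
        Polynomial.aeval (π (X k)) (q'.map σ.toRingEquiv.toRingHom) := by
      intro q'
      rw [Polynomial.aeval_def, Polynomial.eval₂_map, ← hcomp]
      exact Polynomial.hom_eval₂ q' ρ.toRingHom π.toRingHom (X k)
    refine ⟨q.eval₂ ρ.toRingHom (X k), fun hk => ⟨?_, ?_, fun j hj hjk => ?_⟩⟩
    · rw [← hπI, hev, hp0]
    · rw [pderiv_eval₂_rename r k k (fun a ha => hk ⟨a, ha⟩), pderiv_X_self, mul_one, ← hπI, hev,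
        ← Polynomial.derivative_map]
      exact hp1
    · rw [pderiv_eval₂_rename r k j (fun a ha => hj ⟨a, ha⟩), pderiv_X_of_ne hjk.symm, mul_zero]
  choose g hg using key
  refine ⟨Set.range r, g, ?_, hg⟩
  rw [Set.ncard_eq_toFinset_card', Set.toFinset_range, Finset.card_image_of_injective _ hrinj]
  exact_mod_cast hcard

/-- The matrix is block triangular: the rows in `B` kill the `B`-part of a kernel vector, and each
other row then has only its diagonal entry left. -/
lemma eval_det_jacobian_ne_zero_of_block [DecidableEq ι] {B : Set ι} [DecidablePred (· ∈ B)]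
    {g : ι → MvPolynomial ι ℝ} (hg : ∀ k ∉ B, ∀ j ∉ B, j ≠ k → pderiv j (g k) = 0)
    {x : EuclideanSpace ℝ ι} (hx : ∀ k ∉ B, eval (fun i => x i) (pderiv k (g k)) ≠ 0) :
    eval (fun i => x i) (jacobian fun k => if k ∈ B then X k else g k).det ≠ 0 := by
  rw [RingHom.map_det, RingHom.mapMatrix_apply]
  intro h
  obtain ⟨v, hv, hv0⟩ := Matrix.exists_mulVec_eq_zero_iff.2 h
  apply hv
  have hB : ∀ k ∈ B, v k = 0 := by
    intro k hk
    have h1 := congrFun hv0 k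
    simpa [Matrix.mulVec, dotProduct, jacobian, hk, pderiv_X, Pi.single_apply, apply_ite] using h1
  ext k
  by_cases hk : k ∈ B
  · exact hB k hk
  have h1 := congrFun hv0 k
  simp only [Matrix.mulVec, dotProduct, jacobian, Matrix.map_apply, Matrix.of_apply, hk,
    if_false, Pi.zero_apply] at h1
  rw [Finset.sum_eq_single k] at h1
  · simpa [hx k hk] using h1
  · intro j _ hjk
    by_cases hj : j ∈ B
    · simp [hB j hj]
    · simp [hg k hk j hj hjk]
  · simp

lemma dimH_le_of_forall_exists_nhds {X : Type*} [EMetricSpace X] [SecondCountableTopology X]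
    {S : Set X} {d : ENNReal} (h : ∀ x ∈ S, ∃ U ∈ 𝓝 x, dimH (S ∩ U) ≤ d) : dimH S ≤ d := by
  by_contra! hlt
  obtain ⟨x, hx, hxt⟩ := exists_mem_nhdsWithin_lt_dimH_of_lt_dimH hlt
  obtain ⟨U, hU, hUd⟩ := h x hx
  exact (hxt _ (inter_mem self_mem_nhdsWithin (mem_nhdsWithin_of_mem_nhds hU))).not_ge hUd

lemma realLocus_sup_span_singleton (I : Ideal (MvPolynomial ι ℝ)) (f : MvPolynomial ι ℝ) :
    realLocus (I ⊔ Ideal.span {f}) = realLocus I ∩ {x | eval (fun k => x k) f = 0} := by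
  ext x
  refine ⟨fun h => ⟨fun q hq => h q (Ideal.mem_sup_left hq),
    h f (Ideal.mem_sup_right (Ideal.mem_span_singleton_self f))⟩, fun ⟨h1, h2⟩ q hq => ?_⟩
  obtain ⟨a, ha, b, hb, rfl⟩ := Submodule.mem_sup.1 hq
  obtain ⟨c, rfl⟩ := Ideal.mem_span_singleton.1 hb
  have h2' : eval (fun k => x k) f = 0 := h2
  simp [h1 a ha, h2']

lemma lt_sup_span_singleton {R : Type*} [CommRing R] {I : Ideal R} {f : R} (hf : f ∉ I) :
    I < I ⊔ Ideal.span {f} := by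
  refine lt_of_le_of_ne le_sup_left fun h => hf ?_
  rw [h]
  exact Ideal.mem_sup_right (Ideal.mem_span_singleton_self f)

lemma ringKrullDim_quotient_anti {R : Type*} [CommRing R] {I J : Ideal R} (h : I ≤ J) :
    ringKrullDim (R ⧸ J) ≤ ringKrullDim (R ⧸ I) :=
  ringKrullDim_le_of_surjective (Ideal.Quotient.factor h) (Ideal.Quotient.factor_surjective h)

/-- The Hausdorff dimension of a real algebraic set is at most the Krull dimension of the
coordinate ring. -/
theorem dimH_realLocus_le {n : ℕ} (I : Ideal (MvPolynomial ι ℝ))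
    (hn : ringKrullDim (MvPolynomial ι ℝ ⧸ I) ≤ n) : dimH (realLocus I) ≤ n := by
  classical
  -- Noetherian induction: imposing an equation outside `I` enlarges the ideal. In the prime case
  -- the locus is handled by a chart where all `pderiv k (g k)` are nonzero, and by induction
  -- elsewhere; otherwise it splits into two smaller loci.
  induction I using WellFoundedGT.induction with
  | ind I ih =>
  have step : ∀ f ∉ I, dimH (realLocus I ∩ {x | eval (fun k => x k) f = 0}) ≤ n := by
    intro f hf
    rw [← realLocus_sup_span_singleton]
    exact ih _ (lt_sup_span_singleton hf) ((ringKrullDim_quotient_anti le_sup_left).trans hn)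
  by_cases htop : I = ⊤
  · have : realLocus I = ∅ := by
      ext x
      simp only [Set.mem_empty_iff_false, iff_false]
      intro hx
      simpa using hx 1 (by rw [htop]; trivial)
    rw [this, dimH_empty]
    exact zero_le
  by_cases hI : I.IsPrime
  · obtain ⟨B, g, hB, hg⟩ := exists_generic_equations I hn
    set h : MvPolynomial ι ℝ := ∏ k ∈ Finset.univ.filter (· ∉ B), pderiv k (g k) with hh
    have hhI : h ∉ I := by
      rw [hh, hI.prod_mem_iff]
      rintro ⟨k, hk, hkI⟩
      exact (hg k (Finset.mem_filter.1 hk).2).2.1 hkI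
    have hsplit : realLocus I ⊆ (realLocus I ∩ {x | eval (fun k => x k) h ≠ 0}) ∪
        (realLocus I ∩ {x | eval (fun k => x k) h = 0}) := by
      intro x hx
      by_cases h0 : eval (fun k => x k) h = 0
      · exact Or.inr ⟨hx, h0⟩
      · exact Or.inl ⟨hx, h0⟩
    refine (dimH_mono hsplit).trans ?_
    rw [dimH_union]
    refine max_le (dimH_le_of_forall_exists_nhds fun x hx => ?_) (step h hhI)
    have hx0 : ∀ k ∉ B, eval (fun i => x i) (pderiv k (g k)) ≠ 0 := by
      have h1 : eval (fun k => x k) h ≠ 0 := hx.2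
      rw [hh, map_prod, Finset.prod_ne_zero_iff] at h1
      exact fun k hk => h1 k (by simp [hk])
    obtain ⟨U, hU, hUd⟩ := exists_nhds_dimH_le (B := B)
      (S := realLocus I ∩ {x | eval (fun k => x k) h ≠ 0}) (fun y hy k hk => by
        simpa [hk] using hy.1 (g k) (hg k hk).1)
      (eval_det_jacobian_ne_zero_of_block (fun k hk => (hg k hk).2.2) hx0)
    exact ⟨U, hU, hUd.trans (by exact_mod_cast hB)⟩
  · obtain ⟨a, ha, b, hb, hab⟩ : ∃ a, a ∉ I ∧ ∃ b, b ∉ I ∧ a * b ∈ I := by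
      by_contra! hcon
      refine hI ⟨htop, fun {a b} hab => ?_⟩
      by_contra! hc
      exact hcon a hc.1 b hc.2 hab
    have hsplit : realLocus I ⊆ (realLocus I ∩ {x | eval (fun k => x k) a = 0}) ∪
        (realLocus I ∩ {x | eval (fun k => x k) b = 0}) := by
      intro x hx
      have h0 := hx _ hab
      rw [map_mul, mul_eq_zero] at h0
      exact h0.imp (fun h => ⟨hx, h⟩) (fun h => ⟨hx, h⟩)
    refine (dimH_mono hsplit).trans ?_
    rw [dimH_union]
    exact max_le (step a ha) (step b hb)

end Dimension

/-! ### Gaussian conditional independence as a determinant -/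

section Gaussian

/-- The shear `(t, w) ↦ (t, w + f t)` is a measurable equivalence that carries the law of `(T, W)`
to the left side and the product of the marginals to the right side. -/
lemma map_prodMk_add_eq_compProd_iff {Ω β : Type*} [MeasurableSpace Ω] [MeasurableSpace β]
    {μ : Measure Ω} [IsProbabilityMeasure μ] {T : Ω → β} {W : Ω → ℝ} {f : β → ℝ}
    (hT : Measurable T) (hW : Measurable W) (hf : Measurable f) {κ : Kernel β ℝ} [IsSFiniteKernel κ]
    (hκ : ∀ b, κ b = (μ.map W).map (fun w => w + f b)) :
    μ.map (fun ω => (T ω, W ω + f (T ω))) = μ.map T ⊗ₘ κ ↔ IndepFun T W μ := by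
  have := Measure.isProbabilityMeasure_map (μ := μ) hW.aemeasurable
  have := Measure.isProbabilityMeasure_map (μ := μ) hT.aemeasurable
  let e : β × ℝ ≃ᵐ β × ℝ :=
    { toFun := fun z => (z.1, z.2 + f z.1)
      invFun := fun z => (z.1, z.2 - f z.1)
      left_inv := fun z => by simp
      right_inv := fun z => by simp
      measurable_toFun := by
        change Measurable fun z : β × ℝ => (z.1, z.2 + f z.1)
        fun_prop
      measurable_invFun := by
        change Measurable fun z : β × ℝ => (z.1, z.2 - f z.1)
        fun_prop }
  have he : ∀ z, e z = (z.1, z.2 + f z.1) := fun _ => rfl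
  have h1 : μ.map (fun ω => (T ω, W ω + f (T ω))) = (μ.map fun ω => (T ω, W ω)).map e := by
    rw [Measure.map_map e.measurable (by fun_prop)]
    rfl
  have h2 : μ.map T ⊗ₘ κ = ((μ.map T).prod (μ.map W)).map e := by
    ext s hs
    rw [Measure.compProd_apply hs, Measure.map_apply e.measurable hs,
      Measure.prod_apply (e.measurable hs)]
    refine lintegral_congr fun b => ?_
    rw [hκ, Measure.map_apply (by fun_prop) (measurable_prodMk_left hs)]
    rfl
  rw [h1, h2, e.map_measurableEquiv_injective.eq_iff,
    indepFun_iff_map_prod_eq_prod_map_map hT.aemeasurable hW.aemeasurable]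

/-- If `Y = W + f (Z)` with `W` independent of `Z`, then `X` and `Y` are conditionally independent
given `Z` if and only if `W` is independent of `(Z, X)`. -/
lemma condIndepFun_iff_indepFun_residual {Ω β : Type*} [MeasurableSpace Ω] [StandardBorelSpace Ω]
    [MeasurableSpace β] {μ : Measure Ω} [IsProbabilityMeasure μ] {X W : Ω → ℝ} {Z : Ω → β}
    {f : β → ℝ} (hX : Measurable X) (hZ : Measurable Z) (hW : Measurable W) (hf : Measurable f)
    (hZW : IndepFun Z W μ) :
    CondIndepFun (MeasurableSpace.comap Z inferInstance) hZ.comap_le X (fun ω => W ω + f (Z ω)) μ ↔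
      IndepFun (fun ω => (Z ω, X ω)) W μ := by
  have := Measure.isProbabilityMeasure_map (μ := μ) hW.aemeasurable
  have hY : Measurable fun ω => W ω + f (Z ω) := by fun_prop
  -- Given `Z = b`, the variable `W + f (Z)` has the law of `W` shifted by `f b`. Conditional
  -- independence says that this remains its conditional law given `(Z, X)`.
  let κ : Kernel β ℝ := (Kernel.id ×ₖ Kernel.const β (μ.map W)).map fun z => z.2 + f z.1
  have hκ : ∀ b, κ b = (μ.map W).map (fun w => w + f b) := by
    intro b
    rw [Kernel.map_apply _ (by fun_prop), Kernel.prod_apply, Kernel.id_apply, Kernel.const_apply,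
      Measure.dirac_prod, Measure.map_map (by fun_prop) (by fun_prop)]
    rfl
  have : IsMarkovKernel κ := Kernel.IsMarkovKernel.map _ (by fun_prop)
  have h1 : condDistrib (fun ω => W ω + f (Z ω)) Z μ =ᵐ[μ.map Z] κ :=
    condDistrib_ae_eq_of_measure_eq_compProd _ hY.aemeasurable
      ((map_prodMk_add_eq_compProd_iff hZ hW hf hκ).2 hZW)
  have h2 : (condDistrib (fun ω => W ω + f (Z ω)) Z μ).prodMkRight ℝ
      =ᵐ[μ.map fun ω => (Z ω, X ω)] κ.prodMkRight ℝ := by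
    have hfst : μ.map Z = (μ.map fun ω => (Z ω, X ω)).map Prod.fst := by
      rw [Measure.map_map (by fun_prop) (by fun_prop)]
      rfl
    rw [hfst] at h1
    exact ae_of_ae_map (by fun_prop) h1
  have h3 : condDistrib (fun ω => W ω + f (Z ω)) (fun ω => (Z ω, X ω)) μ
        =ᵐ[μ.map fun ω => (Z ω, X ω)] (condDistrib (fun ω => W ω + f (Z ω)) Z μ).prodMkRight ℝ ↔
      condDistrib (fun ω => W ω + f (Z ω)) (fun ω => (Z ω, X ω)) μ
        =ᵐ[μ.map fun ω => (Z ω, X ω)] κ.prodMkRight ℝ :=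
    ⟨fun h => h.trans h2, fun h => h.trans h2.symm⟩
  rw [condIndepFun_iff_condDistrib_prod_ae_eq_prodMkRight hY hX hZ, h3,
    condDistrib_ae_eq_iff_measure_eq_compProd _ hY.aemeasurable]
  exact map_prodMk_add_eq_compProd_iff (T := fun ω => (Z ω, X ω)) (f := fun z => f z.1)
    (hZ.prodMk hX) hW (by fun_prop) (fun b => hκ b.1)

open Matrix

variable {p : ℕ}

/-- The residual of the coordinate `j` after subtracting a linear combination of the coordinates
in `C`. -/
def residual (j : Fin p) (C : Finset (Fin p)) (b : C → ℝ) (x : EuclideanSpace ℝ (Fin p)) : ℝ :=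
  x j - ∑ c, b c * x c

lemma measurable_residual (j : Fin p) (C : Finset (Fin p)) (b : C → ℝ) :
    Measurable (residual j C b) := by
  unfold residual
  fun_prop

lemma memLp_coord (S : Matrix (Fin p) (Fin p) ℝ) (k : Fin p) :
    MemLp (fun x : EuclideanSpace ℝ (Fin p) => x k) 2 (multivariateGaussian 0 S) :=
  (IsGaussian.hasGaussianLaw_id.map_fun
    (EuclideanSpace.proj k : EuclideanSpace ℝ (Fin p) →L[ℝ] ℝ)).memLp_two

lemma covariance_coord_residual {S : Matrix (Fin p) (Fin p) ℝ} (hS : S.PosSemidef)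
    (k j : Fin p) (C : Finset (Fin p)) (b : C → ℝ) :
    cov[fun x : EuclideanSpace ℝ (Fin p) => x k, residual j C b; multivariateGaussian 0 S] =
      S k j - ∑ c, b c * S k c := by
  have hm := memLp_coord S
  have : residual j C b = fun x : EuclideanSpace ℝ (Fin p) => x j - ∑ c, b c * x c := rfl
  rw [this, covariance_fun_sub_right (hm k) (hm j)
      (memLp_finsetSum _ fun (c : C) _ => (hm c).const_mul (b c)),
    covariance_fun_sum_right (fun c : C => (hm c).const_mul (b c)) (hm k),
    covariance_eval_multivariateGaussian hS]
  simp_rw [covariance_const_mul_right, covariance_eval_multivariateGaussian hS]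

lemma memLp_residual (S : Matrix (Fin p) (Fin p) ℝ) (j : Fin p) (C : Finset (Fin p)) (b : C → ℝ) :
    MemLp (residual j C b) 2 (multivariateGaussian 0 S) :=
  (memLp_coord S j).sub (memLp_finsetSum _ fun (c : C) _ => (memLp_coord S c).const_mul (b c))

/-- The coordinates and the residual are jointly Gaussian, so vanishing covariances give
independence. -/
lemma indepFun_coords_residual {S : Matrix (Fin p) (Fin p) ℝ} (hS : S.PosSemidef)
    {κ : Type*} [Finite κ] (v : κ → Fin p) (j : Fin p) (C : Finset (Fin p)) (b : C → ℝ)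
    (h : ∀ k, S (v k) j - ∑ c, b c * S (v k) c = 0) :
    IndepFun (fun (x : EuclideanSpace ℝ (Fin p)) k => x (v k)) (residual j C b)
      (multivariateGaussian 0 S) := by
  have := Fintype.ofFinite κ
  let L : EuclideanSpace ℝ (Fin p) →L[ℝ] (κ → ℝ) × (Unit → ℝ) :=
    (ContinuousLinearMap.pi fun k => EuclideanSpace.proj (v k)).prod
      (ContinuousLinearMap.pi fun _ => EuclideanSpace.proj j - ∑ c, b c • EuclideanSpace.proj c.1)
  have hL : HasGaussianLaw (fun x : EuclideanSpace ℝ (Fin p) =>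
      ((fun k => x (v k)), fun _ : Unit => residual j C b x)) (multivariateGaussian 0 S) := by
    have h0 := (IsGaussian.hasGaussianLaw_id (μ := multivariateGaussian 0 S)).map_fun L
    have h1 : (fun x : EuclideanSpace ℝ (Fin p) =>
        ((fun k => x (v k)), fun _ : Unit => residual j C b x)) = fun x => L (id x) := by
      funext x
      ext <;> simp [L, residual]
    rw [h1]
    exact h0
  have hind := hL.indepFun_of_covariance_eval (X := fun k x => x (v k))
    (Y := fun _ x => residual j C b x) fun k _ => by
      rw [← h k]; exact covariance_coord_residual hS _ _ _ _
  exact hind.comp (φ := id) (ψ := fun w : Unit → ℝ => w ()) measurable_id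
    (measurable_pi_apply ())

/-- Rows `i, C` of the matrix `S` against columns `j, C`. -/
def ciMatrix {R : Type*} (S : Matrix (Fin p) (Fin p) R) (i j : Fin p) (C : Finset (Fin p)) :
    Matrix (Unit ⊕ C) (Unit ⊕ C) R :=
  S.submatrix (Sum.elim (fun _ => i) (fun c => c.1)) (Sum.elim (fun _ => j) (fun c => c.1))

/-- Regress `x j` on `x_C`. The residual is independent of `x_C`, so the statement says that it is
also uncorrelated with `x i`; by the Schur complement, that covariance times the positive minor on
`C` is the determinant. -/
theorem CIStatement.holds_iff {S : Matrix (Fin p) (Fin p) ℝ} (hS : S.PosDef) (s : CIStatement p) :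
    s.Holds S ↔ (ciMatrix S s.i s.j s.C).det = 0 := by
  obtain ⟨i, j, C, hne, hi, hj⟩ := s
  set D : Matrix C C ℝ := S.submatrix (fun c => c.1) (fun c => c.1) with hD
  have hDpos : D.PosDef := hS.submatrix Subtype.val_injective
  have hDdet : IsUnit D.det := hDpos.det_pos.ne'.isUnit
  set b : C → ℝ := D⁻¹ *ᵥ fun c => S c j with hb
  have hDb : ∀ k : C, S k j - ∑ c, b c * S k c = 0 := by
    intro k
    have h1 : D *ᵥ b = fun c => S c.1 j := by
      rw [hb, mulVec_mulVec, mul_nonsing_inv _ hDdet, one_mulVec]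
    have h2 := congrFun h1 k
    simp only [mulVec, dotProduct, hD, submatrix_apply] at h2
    rw [← h2, sub_eq_zero]
    exact Finset.sum_congr rfl fun c _ => mul_comm _ _
  have hdet : (ciMatrix S i j C).det = D.det * (S i j - ∑ c, b c * S i c) := by
    have hbl : ciMatrix S i j C = fromBlocks (of fun _ _ : Unit => S i j)
        (of fun _ (c : C) => S i c) (of fun (c : C) _ => S c j) D := by
      ext (a | a) (c | c) <;> rfl
    have := invertibleOfIsUnitDet D hDdet
    rw [hbl, det_fromBlocks₂₂, Matrix.mul_assoc, invOf_eq_nonsing_inv]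
    congr 1
    rw [det_unique]
    simp only [Matrix.sub_apply, of_apply, Matrix.mul_apply, hb, mulVec, dotProduct]
    congr 1
    exact Finset.sum_congr rfl fun c _ => mul_comm _ _
  rw [hdet, mul_eq_zero_iff_left hDdet.ne_zero]
  have hZ : Measurable (subvector C) := by
    unfold subvector
    fun_prop
  have hX : Measurable fun x : EuclideanSpace ℝ (Fin p) => x i := by fun_prop
  have hW := measurable_residual j C b
  have hZW : IndepFun (subvector C) (residual j C b) (multivariateGaussian 0 S) :=
    indepFun_coords_residual hS.posSemidef (fun c : C => c.1) j C b hDb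
  have hY : (fun x : EuclideanSpace ℝ (Fin p) => x j) =
      fun x => residual j C b x + ∑ c, b c * subvector C x c := by
    ext x; simp [residual, subvector]
  unfold CIStatement.Holds
  simp only
  rw [hY, condIndepFun_iff_indepFun_residual (f := fun z => ∑ c, b c * z c) hX hZ hW
    (by fun_prop) hZW, ← covariance_coord_residual hS.posSemidef]
  constructor
  · intro h
    exact (h.comp measurable_snd measurable_id).covariance_eq_zero (memLp_coord S i)
      (memLp_residual S j C b)
  · intro h
    rw [covariance_coord_residual hS.posSemidef] at h
    have h1 := indepFun_coords_residual hS.posSemidef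
      (fun o : Option C => o.elim i fun c => c.1) j C b (by rintro (_ | c); exacts [h, hDb c])
    exact h1.comp (φ := fun z => ((fun c => z (some c)), z none)) (ψ := id)
      (by fun_prop) measurable_id

end Gaussian

/-! ### Proper subsets of irreducible models -/

section Irreducible

open MvPolynomial

variable {ι : Type*} [Fintype ι]

/-- The ideal of polynomials that vanish on `A`. -/
def idealOf (A : Set (EuclideanSpace ℝ ι)) : Ideal (MvPolynomial ι ℝ) :=
  vanishingIdeal ℝ ((fun θ : EuclideanSpace ℝ ι => fun k => θ k) '' A)

lemma mem_idealOf {A : Set (EuclideanSpace ℝ ι)} {f : MvPolynomial ι ℝ} :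
    f ∈ idealOf A ↔ ∀ θ ∈ A, eval (fun k => θ k) f = 0 := by
  simp [idealOf, mem_vanishingIdeal_iff, aeval_eq_eval]

lemma idealOf_anti {A B : Set (EuclideanSpace ℝ ι)} (h : A ⊆ B) : idealOf B ≤ idealOf A :=
  fun _ hf => mem_idealOf.2 fun θ hθ => mem_idealOf.1 hf θ (h hθ)

lemma subset_realLocus_idealOf (A : Set (EuclideanSpace ℝ ι)) : A ⊆ realLocus (idealOf A) :=
  fun θ hθ _ hf => mem_idealOf.1 hf θ hθ

lemma IsAlgebraicModel.inter_zero {Θ A : Set (EuclideanSpace ℝ ι)} (hA : IsAlgebraicModel Θ A)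
    (f : MvPolynomial ι ℝ) : IsAlgebraicModel Θ {θ ∈ A | eval (fun k => θ k) f = 0} := by
  obtain ⟨P, rfl⟩ := hA
  refine ⟨insert f P, ?_⟩
  ext θ
  simp only [Set.mem_setOf_eq, Set.mem_insert_iff, forall_eq_or_imp]
  tauto

/-- If `f * g` vanishes on `V`, then `V` is the union of the submodels `f = 0` and `g = 0`, so one
of them is `V`. -/
lemma IsIrreducibleModel.isPrime_idealOf {Θ V : Set (EuclideanSpace ℝ ι)}
    (hV : IsIrreducibleModel Θ V) : (idealOf V).IsPrime := by
  obtain ⟨hA, ⟨θ, hθ⟩, hirr⟩ := hV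
  refine ⟨fun h => ?_, fun {f g} hfg => ?_⟩
  · have h1 : (1 : MvPolynomial ι ℝ) ∈ idealOf V := by rw [h]; trivial
    simpa using mem_idealOf.1 h1 θ hθ
  · have hun : V = {θ ∈ V | eval (fun k => θ k) f = 0} ∪ {θ ∈ V | eval (fun k => θ k) g = 0} := by
      ext x
      refine ⟨fun hx => ?_, fun hx => hx.elim And.left And.left⟩
      have h1 := mem_idealOf.1 hfg x hx
      rw [map_mul, mul_eq_zero] at h1
      exact h1.imp (fun h => ⟨hx, h⟩) (fun h => ⟨hx, h⟩)
    refine (hirr _ _ (hA.inter_zero f) (hA.inter_zero g) hun).imp (fun h => ?_) (fun h => ?_)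
    · rw [mem_idealOf]; intro x hx; rw [h] at hx; exact hx.2
    · rw [mem_idealOf]; intro x hx; rw [h] at hx; exact hx.2

lemma modelDim_eq (A : Set (EuclideanSpace ℝ ι)) :
    modelDim A = ringKrullDim (MvPolynomial ι ℝ ⧸ idealOf A) := rfl

lemma exists_nat_eq_modelDim {A : Set (EuclideanSpace ℝ ι)} (hA : A.Nonempty) :
    ∃ d : ℕ, modelDim A = d := by
  have hnt : Nontrivial (MvPolynomial ι ℝ ⧸ idealOf A) := by
    rw [Ideal.Quotient.nontrivial_iff]
    intro h
    obtain ⟨θ, hθ⟩ := hA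
    have h1 : (1 : MvPolynomial ι ℝ) ∈ idealOf A := by rw [h]; trivial
    simpa using mem_idealOf.1 h1 θ hθ
  have h0 : (0 : WithBot ℕ∞) ≤ modelDim A := by
    rw [modelDim_eq]
    exact ringKrullDim_nonneg_of_nontrivial
  have h1 : modelDim A ≤ (Nat.card ι : WithBot ℕ∞) := by
    refine (ringKrullDim_quotient_le (idealOf A)).trans ?_
    rw [MvPolynomial.ringKrullDim_of_isNoetherianRing, ringKrullDim_eq_zero_of_field, zero_add]
  generalize modelDim A = x at h0 h1
  induction x using WithBot.recBotCoe with
  | bot => simp at h0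
  | coe a =>
    have h2 : a ≤ (Nat.card ι : ℕ∞) := by exact_mod_cast h1
    lift a to ℕ using ne_top_of_le_ne_top (by simp) h2
    exact ⟨a, rfl⟩

lemma lt_of_add_one_le_natCast {x : WithBot ℕ∞} {d : ℕ} (h : x + 1 ≤ d) : x < d := by
  induction x using WithBot.recBotCoe with
  | bot => exact WithBot.bot_lt_coe _
  | coe a =>
    have h1 : a + 1 ≤ (d : ℕ∞) := by exact_mod_cast h
    have h2 : a < (d : ℕ∞) := (ENat.add_one_le_iff (by
      rintro rfl
      simp at h1)).1 h1
    exact_mod_cast h2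

/-- The class of `h` is nonzero in the domain `ℝ[x] / I(V)`, hence a nonzerodivisor, and dies on `S
∩ V`; so the Krull dimension drops by at least one, and the Hausdorff dimension is below `d` too. -/
theorem IsIrreducibleModel.isNullWithin {Θ V S : Set (EuclideanSpace ℝ ι)}
    (hV : IsIrreducibleModel Θ V) {h : MvPolynomial ι ℝ} {θ₀ : EuclideanSpace ℝ ι} (hθ₀ : θ₀ ∈ V)
    (h0 : eval (fun k => θ₀ k) h ≠ 0) (hS : ∀ θ ∈ S ∩ V, eval (fun k => θ k) h = 0) :
    IsNullWithin V S := by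
  obtain ⟨d, hd⟩ := exists_nat_eq_modelDim hV.2.1
  have hprime := hV.isPrime_idealOf
  have hlt : modelDim (S ∩ V) < d := by
    refine lt_of_add_one_le_natCast (hd ▸ ?_)
    have hle : idealOf V ≤ idealOf (S ∩ V) := idealOf_anti Set.inter_subset_right
    rw [modelDim_eq, modelDim_eq]
    refine ringKrullDim_succ_le_of_surjective (Ideal.Quotient.factor hle)
      (Ideal.Quotient.factor_surjective hle) (r := Ideal.Quotient.mk _ h) ?_ ?_
    · rw [mem_nonZeroDivisors_iff_ne_zero, Ne, Ideal.Quotient.eq_zero_iff_mem]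
      exact fun hh => h0 (mem_idealOf.1 hh θ₀ hθ₀)
    · rw [Ideal.Quotient.factor_mk, Ideal.Quotient.eq_zero_iff_mem]
      exact mem_idealOf.2 hS
  refine ⟨d, hd, hlt, ?_⟩
  rcases (S ∩ V).eq_empty_or_nonempty with he | hne
  · rw [he, measure_empty]
  obtain ⟨m, hm⟩ := exists_nat_eq_modelDim hne
  have hmd : m < d := by rw [hm] at hlt; exact_mod_cast hlt
  have hdim : dimH (S ∩ V) ≤ m :=
    (dimH_mono (subset_realLocus_idealOf _)).trans (dimH_realLocus_le _ hm.le)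
  exact hausdorffMeasure_of_dimH_lt (d := d) (hdim.trans_lt (by exact_mod_cast hmd))

end Irreducible

/-! ### First-order behaviour of the determinants -/

section DetPolynomial

open MvPolynomial Matrix

variable {ι : Type*} {p : ℕ}

lemma eval_pderiv_prod_eq_zero {κ : Type*} [Fintype κ] (f : κ → MvPolynomial ι ℝ) (x : ι → ℝ)
    {a b : κ} (hab : a ≠ b) (ha : eval x (f a) = 0) (hb : eval x (f b) = 0) (k : ι) :
    eval x (pderiv k (∏ c, f c)) = 0 := by
  classical
  rw [← Finset.mul_prod_erase _ f (Finset.mem_univ a),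
    ← Finset.mul_prod_erase _ f (Finset.mem_erase.2 ⟨hab.symm, Finset.mem_univ b⟩)]
  simp [Derivation.leibniz, ha, hb]

/-- A nonidentity permutation uses at least two off-diagonal entries, which vanish at `x`, so its
term has no first-order part. The identity contributes `Q i j * ∏ c, Q c c`, whose first factor
vanishes at `x`. -/
lemma eval_pderiv_det_ciMatrix {Q : Matrix (Fin p) (Fin p) (MvPolynomial ι ℝ)} {x : ι → ℝ}
    (hQ : ∀ k l, k ≠ l → eval x (Q k l) = 0) {i j : Fin p} {C : Finset (Fin p)} (hij : i ≠ j)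
    (hi : i ∉ C) (hj : j ∉ C) (k : ι) :
    eval x (pderiv k (ciMatrix Q i j C).det) =
      eval x (pderiv k (Q i j)) * ∏ c : C, eval x (Q c c) := by
  classical
  have hne : ∀ a b : Unit ⊕ C, a ≠ b → eval x (ciMatrix Q i j C a b) = 0 := by
    rintro (a | a) (b | b) hab
    · exact absurd rfl hab
    · exact hQ _ _ fun h : i = b.1 => hi (h ▸ b.2)
    · exact hQ _ _ fun h : a.1 = j => hj (h ▸ a.2)
    · exact hQ _ _ fun h => hab (by rw [Subtype.ext h])
  rw [det_apply, map_sum, map_sum, Finset.sum_eq_single 1]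
  · have : ∏ a, ciMatrix Q i j C ((1 : Equiv.Perm (Unit ⊕ C)) a) a = Q i j * ∏ c : C, Q c c := by
      simp [Fintype.prod_sum_type, ciMatrix]
    rw [Equiv.Perm.sign_one, one_smul, this]
    simp [Derivation.leibniz, hQ i j hij, mul_comm]
  · intro σ _ hσ
    obtain ⟨a, ha⟩ : ∃ a, σ a ≠ a := by
      by_contra! h
      exact hσ (Equiv.ext h)
    -- A moved index `a` and its image `σ a`, also moved, give two distinct vanishing factors.
    have h1 := eval_pderiv_prod_eq_zero (fun a => ciMatrix Q i j C (σ a) a) x ha.symm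
      (hne _ _ ha) (hne _ _ (fun h => ha (σ.injective h))) k
    rcases Int.units_eq_one_or (Equiv.Perm.sign σ) with hs | hs
    · rw [hs, one_smul, h1]
    · rw [hs, Units.neg_smul, one_smul, map_neg, map_neg, h1, neg_zero]
  · simp

lemma det_ciMatrix_map {R : Type*} [CommRing R] {R' : Type*} [CommRing R'] (φ : R →+* R')
    (Q : Matrix (Fin p) (Fin p) R) (i j : Fin p) (C : Finset (Fin p)) :
    φ (ciMatrix Q i j C).det = (ciMatrix (Q.map φ) i j C).det := by
  rw [RingHom.map_det]
  rfl

lemma det_ciMatrix_eq_zero_of_isDiag {D : Matrix (Fin p) (Fin p) ℝ} (hD : D.IsDiag) {i j : Fin p}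
    {C : Finset (Fin p)} (hij : i ≠ j) (hj : j ∉ C) : (ciMatrix D i j C).det = 0 := by
  refine det_eq_zero_of_column_eq_zero (Sum.inl ()) ?_
  rintro (a | a)
  · exact hD hij
  · exact hD fun h : a.1 = j => hj (h ▸ a.2)

lemma det_ciMatrix_swap {R : Type*} [CommRing R] {Q : Matrix (Fin p) (Fin p) R} (hQ : Q.IsSymm)
    (i j : Fin p) (C : Finset (Fin p)) : (ciMatrix Q j i C).det = (ciMatrix Q i j C).det := by
  rw [← det_transpose]
  congr 1
  ext a b
  simp only [ciMatrix, transpose_apply, submatrix_apply]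
  rw [hQ.apply]

end DetPolynomial

/-! ### Covariance and correlation models treated together -/

section Parametrization

open MvPolynomial Matrix

variable {p : ℕ} {ι : Type*}

/-- A parametrization of symmetric matrices whose off-diagonal entries are distinct coordinates;
the diagonal entries may be coordinates or constants. -/
structure Param (p : ℕ) (ι : Type*) where
  entry : Matrix (Fin p) (Fin p) (MvPolynomial ι ℝ)
  pair : ι → Sym2 (Fin p)
  pair_injective : Function.Injective pair
  entry_isSymm : entry.IsSymm
  exists_coord : ∀ i j, i ≠ j → ∃ e, pair e = s(i, j) ∧ entry i j = X e

namespace Param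

variable (Q : Param p ι)

/-- The matrix with parameter `θ`. -/
def mat (θ : EuclideanSpace ℝ ι) : Matrix (Fin p) (Fin p) ℝ :=
  Q.entry.map (eval fun k => θ k)

lemma isSymm_mat (θ : EuclideanSpace ℝ ι) : (Q.mat θ).IsSymm := by
  ext i j
  simp only [mat, transpose_apply, map_apply]
  rw [Q.entry_isSymm.apply]

/-- The set of parameters of positive definite matrices. -/
def space : Set (EuclideanSpace ℝ ι) := {θ | (Q.mat θ).PosDef}

/-- The set of parameters for which all statements in `I` hold. -/
def model (I : IndepModel p) : Set (EuclideanSpace ℝ ι) :=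
  {θ ∈ Q.space | ∀ s ∈ I, s.Holds (Q.mat θ)}

/-- The coordinates belonging to pairs that are not adjacent in `I`. -/
def nonadj (I : IndepModel p) : Set ι := {e | ∃ s ∈ I, s(s.i, s.j) = Q.pair e}

/-- The determinantal equation of the statement in `I` for the pair `e`. -/
def equation (I : IndepModel p) (e : ι) : MvPolynomial ι ℝ := by
  classical
  -- The default 0 is harmless: equations are only used for pairs in `nonadj I`.
  exact if h : e ∈ Q.nonadj I then (ciMatrix Q.entry h.choose.i h.choose.j h.choose.C).det else 0

lemma exists_equation_eq {I : IndepModel p} {e : ι} (he : e ∈ Q.nonadj I) :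
    ∃ s ∈ I, s(s.i, s.j) = Q.pair e ∧
      Q.equation I e = (ciMatrix Q.entry s.i s.j s.C).det :=
  ⟨he.choose, he.choose_spec.1, he.choose_spec.2, by rw [equation, dif_pos he]⟩

/-- By simplicity all statements in `I` for one pair share their conditioning set, so they differ at
most by swapping `i` and `j`, which preserves the determinant of a symmetric matrix. One chosen
equation per pair suffices. -/
lemma model_eq_zeroModel [Fintype ι] {I : IndepModel p} (hI : I.IsSimple) :
    Q.model I = zeroModel Q.space (Q.nonadj I) (Q.equation I) := by
  ext θ
  refine and_congr_right fun hθ => ?_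
  have hev : ∀ s : CIStatement p, s.Holds (Q.mat θ) ↔
      eval (fun k => θ k) (ciMatrix Q.entry s.i s.j s.C).det = 0 := by
    intro s
    rw [s.holds_iff hθ, det_ciMatrix_map]
    rfl
  constructor
  · intro h e he
    obtain ⟨s, hs, -, hse⟩ := Q.exists_equation_eq he
    rw [hse, ← hev]
    exact h s hs
  · intro h s hs
    obtain ⟨e, he, -⟩ := Q.exists_coord s.i s.j s.ne
    have hmem : e ∈ Q.nonadj I := ⟨s, hs, he.symm⟩
    obtain ⟨t, ht, hte, heq⟩ := Q.exists_equation_eq hmem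
    have h1 := h e hmem
    have hpair : s(s.i, s.j) = s(t.i, t.j) := by rw [hte, he]
    rw [heq, ← hI s hs t ht hpair] at h1
    rw [hev]
    rcases Sym2.eq_iff.1 hpair with ⟨h2, h3⟩ | ⟨h2, h3⟩
    · rw [h2, h3]; exact h1
    · rw [h2, h3, det_ciMatrix_swap Q.entry_isSymm]; exact h1

lemma isAdapted_equation [Fintype ι] (I : IndepModel p) {θ₀ : EuclideanSpace ℝ ι}
    (hθ₀ : θ₀ ∈ Q.space) (hd : (Q.mat θ₀).IsDiag) :
    IsAdapted (Q.nonadj I) (Q.equation I) θ₀ := by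
  classical
  have hoff : ∀ k l, k ≠ l → eval (fun k => θ₀ k) (Q.entry k l) = 0 := fun k l hkl => hd hkl
  have hcoord : ∀ s : CIStatement p, ∀ e, s(s.i, s.j) = Q.pair e → Q.entry s.i s.j = X e := by
    intro s e hs
    obtain ⟨e', he', hX⟩ := Q.exists_coord s.i s.j s.ne
    rw [hX, Q.pair_injective (he'.trans hs)]
  refine ⟨fun e he => ?_, fun e he => ?_, fun e he => ?_, fun e he k hk => ?_⟩ <;>
    obtain ⟨s, -, hse, heq⟩ := Q.exists_equation_eq he
  · have h1 := hoff s.i s.j s.ne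
    rwa [hcoord s e hse, eval_X] at h1
  · rw [heq, det_ciMatrix_map]
    exact det_ciMatrix_eq_zero_of_isDiag hd s.ne s.right_notMem
  · rw [heq, eval_pderiv_det_ciMatrix hoff s.ne s.left_notMem s.right_notMem, hcoord s e hse,
      pderiv_X_self, map_one, one_mul, Finset.prod_ne_zero_iff]
    exact fun c _ => (PosDef.diag_pos hθ₀ (i := c.1)).ne'
  · rw [heq, eval_pderiv_det_ciMatrix hoff s.ne s.left_notMem s.right_notMem, hcoord s e hse,
      pderiv_X_of_ne hk.symm, map_zero, zero_mul]

/-- Positivity of the quadratic form need only be checked on the unit sphere, and compactness makes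
it persist for nearby parameters. -/
lemma isOpen_space [Fintype ι] : IsOpen Q.space := by
  have hcont : Continuous fun z : EuclideanSpace ℝ ι × (Fin p → ℝ) => z.2 ⬝ᵥ (Q.mat z.1) *ᵥ z.2 := by
    have hmat : ∀ i j, Continuous fun z : EuclideanSpace ℝ ι × (Fin p → ℝ) => Q.mat z.1 i j :=
      fun i j => (contDiff_eval (Q.entry i j)).continuous.comp continuous_fst
    simp only [dotProduct, mulVec]
    fun_prop
  have hiff : ∀ θ, θ ∈ Q.space ↔
      ∀ v ∈ Metric.sphere (0 : Fin p → ℝ) 1, 0 < v ⬝ᵥ (Q.mat θ) *ᵥ v := by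
    intro θ
    refine ⟨fun h v hv => ?_, fun h => ?_⟩
    · have hv0 : v ≠ 0 := by
        rintro rfl
        simp at hv
      simpa using h.dotProduct_mulVec_pos hv0
    · refine PosDef.of_dotProduct_mulVec_pos ?_ fun v hv => ?_
      · ext i j
        simp [(Q.isSymm_mat θ).apply]
      · have hn : 0 < ‖v‖ := norm_pos_iff.2 hv
        have h1 := h (‖v‖⁻¹ • v) (by simp [norm_smul, hn.ne'])
        rw [mulVec_smul, smul_dotProduct, dotProduct_smul, smul_eq_mul, smul_eq_mul] at h1
        have h2 : 0 < v ⬝ᵥ (Q.mat θ) *ᵥ v := by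
          by_contra! h3
          have h4 : 0 < ‖v‖⁻¹ := inv_pos.2 hn
          nlinarith [mul_pos h4 h4]
        simpa using h2
  rw [isOpen_iff_mem_nhds]
  intro θ hθ
  have hev : ∀ᶠ θ' in 𝓝 θ, ∀ v ∈ Metric.sphere (0 : Fin p → ℝ) 1, 0 < v ⬝ᵥ (Q.mat θ') *ᵥ v := by
    refine (isCompact_sphere _ _).eventually_forall_of_forall_eventually fun v hv => ?_
    have h0 := (hiff θ).1 hθ v hv
    exact hcont.continuousAt.eventually (lt_mem_nhds h0)
  filter_upwards [hev] with θ' h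
  exact (hiff θ').2 h

lemma adjacency_adj_iff (I : IndepModel p) {i j : Fin p} (hij : i ≠ j) {e : ι}
    (he : Q.pair e = s(i, j)) : I.adjacency.Adj i j ↔ e ∉ Q.nonadj I := by
  simp only [IndepModel.adjacency, nonadj, Set.mem_setOf_eq, he, not_exists, not_and]
  exact and_iff_right hij

lemma adjacency_eq_iff (I₁ I₂ : IndepModel p) :
    I₁.adjacency = I₂.adjacency ↔ Q.nonadj I₁ = Q.nonadj I₂ := by
  have hlt : ∀ J₁ J₂ : IndepModel p, J₁.adjacency = J₂.adjacency →
      Q.nonadj J₁ ⊆ Q.nonadj J₂ := by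
    intro J₁ J₂ h e he
    have he' := he
    obtain ⟨s, -, hse⟩ := he'
    by_contra hc
    rw [← Q.adjacency_adj_iff J₂ s.ne hse.symm, ← h, Q.adjacency_adj_iff J₁ s.ne hse.symm] at hc
    exact hc he
  refine ⟨fun h => (hlt _ _ h).antisymm (hlt _ _ h.symm), fun h => ?_⟩
  ext i j
  by_cases hij : i = j
  · subst hij
    simp
  · obtain ⟨e, he, -⟩ := Q.exists_coord i j hij
    rw [Q.adjacency_adj_iff I₁ hij he, Q.adjacency_adj_iff I₂ hij he, h]

variable [Fintype ι] {I₁ I₂ : IndepModel p}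

theorem isNearEquivAt_model (h₁ : I₁.IsSimple) (h₂ : I₂.IsSimple)
    (hadj : I₁.adjacency = I₂.adjacency) {θ : EuclideanSpace ℝ ι} (hθ : θ ∈ Q.space)
    (hd : (Q.mat θ).IsDiag) : IsNearEquivAt 2 (Q.model I₁) (Q.model I₂) θ := by
  classical
  rw [Q.model_eq_zeroModel h₁, Q.model_eq_zeroModel h₂, (Q.adjacency_eq_iff I₁ I₂).1 hadj]
  refine isNearEquivAt_zeroModel (Q.isOpen_space.mem_nhds hθ) ?_ (Q.isAdapted_equation I₂ hθ hd)
  have h := Q.isAdapted_equation I₁ hθ hd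
  rwa [(Q.adjacency_eq_iff I₁ I₂).1 hadj] at h

theorem isNullWithin_isEquivAt (h₁ : I₁.IsSimple) (h₂ : I₂.IsSimple)
    (hadj : I₁.adjacency ≠ I₂.adjacency) {V : Set (EuclideanSpace ℝ ι)}
    (hV : IsIrreducibleModel Q.space V) {θ₀ : EuclideanSpace ℝ ι} (hθ₀ : θ₀ ∈ V)
    (hd : (Q.mat θ₀).IsDiag) :
    IsNullWithin V {θ | IsEquivAt 1 (Q.model I₁) (Q.model I₂) θ} := by
  classical
  have hVs : V ⊆ Q.space := by
    obtain ⟨⟨P, rfl⟩, -⟩ := hV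
    exact fun θ hθ => hθ.1
  have hmain : ∀ J₁ J₂ : IndepModel p, J₁.IsSimple → J₂.IsSimple →
      (∃ e, e ∉ Q.nonadj J₁ ∧ e ∈ Q.nonadj J₂) →
      IsNullWithin V {θ | IsEquivAt 1 (Q.model J₁) (Q.model J₂) θ} := by
    rintro J₁ J₂ hJ₁ hJ₂ ⟨e, he₁, he₂⟩
    refine hV.isNullWithin hθ₀ (eval_det_jacobian_augment_ne_zero
      (Q.isAdapted_equation J₁ (hVs hθ₀) hd) (Q.isAdapted_equation J₂ (hVs hθ₀) hd) he₂) ?_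
    rintro θ ⟨hθ, hθV⟩
    rw [Set.mem_setOf_eq, Q.model_eq_zeroModel hJ₁, Q.model_eq_zeroModel hJ₂] at hθ
    exact hθ.eval_det_jacobian_eq_zero (Q.isOpen_space.mem_nhds (hVs hθV)) he₁ he₂
  have hne : Q.nonadj I₁ ≠ Q.nonadj I₂ := fun h => hadj ((Q.adjacency_eq_iff I₁ I₂).2 h)
  -- The distinguishing pair may belong to either model; symmetry of 1-equivalence allows swapping
  -- them.
  by_cases hsub : Q.nonadj I₂ ⊆ Q.nonadj I₁
  · obtain ⟨e, he₁, he₂⟩ := Set.not_subset.1 fun h => hne (h.antisymm hsub)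
    have hsymm : {θ | IsEquivAt 1 (Q.model I₁) (Q.model I₂) θ} =
        {θ | IsEquivAt 1 (Q.model I₂) (Q.model I₁) θ} :=
      Set.ext fun θ => ⟨fun h => h.symm, fun h => h.symm⟩
    rw [hsymm]
    exact hmain _ _ h₂ h₁ ⟨e, he₂, he₁⟩
  · obtain ⟨e, he₂, he₁⟩ := Set.not_subset.1 hsub
    exact hmain _ _ h₁ h₂ ⟨e, he₁, he₂⟩

end Param

/-- Covariance matrices, parametrized by their entries on and above the diagonal. -/
def covParam (p : ℕ) : Param p (CovIndex p) where
  entry := Matrix.of fun i j => X s(i, j)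
  pair := id
  pair_injective := Function.injective_id
  entry_isSymm := by
    ext i j
    simp [Sym2.eq_swap]
  exists_coord i j _ := ⟨s(i, j), rfl, rfl⟩

/-- Correlation matrices, parametrized by their entries above the diagonal. -/
def corParam (p : ℕ) : Param p (CorIndex p) where
  entry := Matrix.of fun i j => if h : i = j then 1 else X ⟨s(i, j), h⟩
  pair := Subtype.val
  pair_injective := Subtype.val_injective
  entry_isSymm := by
    ext i j : 2
    by_cases h : i = j
    · simp [h]
    · simp [h, Ne.symm h, Sym2.eq_swap (a := i)]
  exists_coord i j h := ⟨⟨s(i, j), h⟩, rfl, by simp [h]⟩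

lemma covParam_mat (θ : EuclideanSpace ℝ (CovIndex p)) : (covParam p).mat θ = toCov θ := by
  ext i j
  simp [covParam, Param.mat, toCov]

lemma corParam_mat (θ : EuclideanSpace ℝ (CorIndex p)) : (corParam p).mat θ = toCor θ := by
  ext i j
  by_cases h : i = j <;> simp [corParam, Param.mat, toCor, h]

lemma covParam_space : (covParam p).space = covSpace p := by
  simp only [Param.space, covSpace, covParam_mat]

lemma corParam_space : (corParam p).space = corSpace p := by
  simp only [Param.space, corSpace, corParam_mat]

lemma covParam_model (I : IndepModel p) : (covParam p).model I = covModel I := by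
  simp only [Param.model, covModel, covParam_mat, covParam_space]

lemma corParam_model (I : IndepModel p) : (corParam p).model I = corModel I := by
  simp only [Param.model, corModel, corParam_mat, corParam_space]

end Parametrization

end LocalEquiv

end

theorem mainTheorem7 (p : ℕ) (I₁ I₂ : LocalEquiv.IndepModel p)
    (h₁ : I₁.IsSimple) (h₂ : I₂.IsSimple) :
    (I₁.adjacency = I₂.adjacency →
      (∀ θ ∈ LocalEquiv.covSpace p, (LocalEquiv.toCov θ).IsDiag →
        LocalEquiv.IsNearEquivAt 2 (LocalEquiv.covModel I₁) (LocalEquiv.covModel I₂) θ) ∧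
      (∀ θ : EuclideanSpace ℝ (LocalEquiv.CorIndex p), LocalEquiv.toCor θ = 1 →
        LocalEquiv.IsNearEquivAt 2 (LocalEquiv.corModel I₁) (LocalEquiv.corModel I₂) θ)) ∧
    (I₁.adjacency ≠ I₂.adjacency →
      (∀ V : Set (EuclideanSpace ℝ (LocalEquiv.CovIndex p)),
        LocalEquiv.IsIrreducibleModel (LocalEquiv.covSpace p) V →
        (∃ θ₀ ∈ V, (LocalEquiv.toCov θ₀).IsDiag) →
        LocalEquiv.IsNullWithin V
          {θ | LocalEquiv.IsEquivAt 1 (LocalEquiv.covModel I₁) (LocalEquiv.covModel I₂) θ}) ∧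
      (∀ V : Set (EuclideanSpace ℝ (LocalEquiv.CorIndex p)),
        LocalEquiv.IsIrreducibleModel (LocalEquiv.corSpace p) V →
        (∃ θ₀ ∈ V, LocalEquiv.toCor θ₀ = 1) →
        LocalEquiv.IsNullWithin V
          {θ | LocalEquiv.IsEquivAt 1 (LocalEquiv.corModel I₁) (LocalEquiv.corModel I₂) θ})) := by
  simp only [← LocalEquiv.covParam_model, ← LocalEquiv.corParam_model,
    ← LocalEquiv.covParam_space, ← LocalEquiv.corParam_space,
    ← LocalEquiv.covParam_mat, ← LocalEquiv.corParam_mat]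
  have hone : (1 : Matrix (Fin p) (Fin p) ℝ).IsDiag := Matrix.isDiag_one
  refine ⟨fun h => ⟨fun θ hθ hd => LocalEquiv.Param.isNearEquivAt_model _ h₁ h₂ h hθ hd,
    fun θ hθ => LocalEquiv.Param.isNearEquivAt_model _ h₁ h₂ h ?_ (hθ ▸ hone)⟩,
    fun h => ⟨?_, ?_⟩⟩
  · change ((LocalEquiv.corParam p).mat θ).PosDef
    rw [hθ]
    exact Matrix.PosDef.one
  · rintro V hV ⟨θ₀, hθ₀, hd⟩
    exact LocalEquiv.Param.isNullWithin_isEquivAt _ h₁ h₂ h hV hθ₀ hd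
  · rintro V hV ⟨θ₀, hθ₀, hd⟩
    exact LocalEquiv.Param.isNullWithin_isEquivAt _ h₁ h₂ h hV hθ₀ (hd ▸ hone)
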